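/- Let $G$ be a Fuchsian group, i.e. a discrete subgroup of $SL(2,\mathbb{R})$, acting on the hyperbolic plane $\mathbb{H}^2$ by Möbius transformations, and suppose that the quotient $G\backslash\mathbb{H}^2$ has finite hyperbolic area but is not compact. Let $G$ act on the circle $S^1=\partial\mathbb{D}$ at infinity of the unit disc model $\mathbb{D}$ of $\mathbb{H}^2$ (obtained from the upper half-plane by the Cayley transform $z\mapsto (z-i)/(z+i)$), and for $g\in G$ and $p\in S^1$ let $|g'(p)|$ denote the absolute value of the derivative of $g:S^1\to S^1$ at $p$ with respect to the angle. Let $S$ be any finite generating set of $G$, and for $R\in\mathbb{N}$ let $B(R)\subset G$ be the ball of radius $R$ about the identity in the word metric of $S$. Then for Lebesgue-almost every $p\in S^1$ the Lyapunov expansion exponent $$\lambda_{exp}(p):=\limsup_{R\to\infty}\ \max_{g\in B(R)}\ \frac1R\log|g'(p)|$$ is equal to $0$. -/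

import Mathlib

open scoped MatrixGroups UpperHalfPlane ComplexConjugate

noncomputable section

namespace Fuchsian

/-! ### Isometries in the disc model

The Cayley transform `z ↦ (z - i) / (z + i)` identifies the upper half-plane with the unit disc and
turns `g = !![a, b; c, d]` into the Möbius map `w ↦ (α w + β) / (conj β w + conj α)`, which extends
to the boundary circle. -/

/-- The coefficient `α = ((a + d) + i (b - c)) / 2`. -/
def discA (g : SL(2, ℝ)) : ℂ := ⟨(g 0 0 + g 1 1) / 2, (g 0 1 - g 1 0) / 2⟩

/-- The coefficient `β = ((a - d) - i (b + c)) / 2`. -/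
def discB (g : SL(2, ℝ)) : ℂ := ⟨(g 0 0 - g 1 1) / 2, -(g 0 1 + g 1 0) / 2⟩

/-- The Möbius map of the disc model given by `g`, as a formula on `ℂ`. -/
def discMap (g : SL(2, ℝ)) (w : ℂ) : ℂ :=
  (discA g * w + discB g) / (conj (discB g) * w + conj (discA g))

/-- The Cayley transform from the upper half-plane to the unit disc. -/
def cayley (z : ℍ) : ℂ := ((z : ℂ) - Complex.I) / ((z : ℂ) + Complex.I)

lemma normSq_discA_sub (g : SL(2, ℝ)) :
    Complex.normSq (discA g) - Complex.normSq (discB g) = 1 := by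
  have h := g.det_coe
  rw [Matrix.det_fin_two] at h
  simp only [discA, discB, Complex.normSq_mk]
  linarith

lemma discMap_denom_ne_zero (g : SL(2, ℝ)) {w : ℂ} (hw : ‖w‖ ≤ 1) :
    conj (discB g) * w + conj (discA g) ≠ 0 := by
  intro h
  have h1 : ‖discA g‖ = ‖discB g‖ * ‖w‖ := by
    have := congrArg norm (eq_neg_of_add_eq_zero_right h)
    simpa using this
  have h2 := normSq_discA_sub g
  rw [Complex.normSq_eq_norm_sq, Complex.normSq_eq_norm_sq] at h2
  have h3 : ‖discA g‖ ≤ ‖discB g‖ := by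
    rw [h1]; exact mul_le_of_le_one_right (norm_nonneg _) hw
  nlinarith [norm_nonneg (discA g), norm_nonneg (discB g)]

/-- `discMap g` is the action of `g` on the upper half-plane, read through the Cayley transform. -/
theorem cayley_smul (g : SL(2, ℝ)) (z : ℍ) : cayley (g • z) = discMap g (cayley z) := by
  have hz : (z : ℂ) + Complex.I ≠ 0 := by
    intro h
    have := congrArg Complex.im h
    simp at this
    linarith [z.im_pos]
  have hd : (g 1 0 : ℂ) * z + g 1 1 ≠ 0 := by
    have := UpperHalfPlane.denom_ne_zero (g : GL (Fin 2) ℝ) z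
    simpa [UpperHalfPlane.denom] using this
  have hz' : ((g • z : ℍ) : ℂ) + Complex.I ≠ 0 := by
    intro h
    have := congrArg Complex.im h
    simp only [Complex.add_im, UpperHalfPlane.coe_im, Complex.I_im, Complex.zero_im] at this
    linarith [(g • z).im_pos]
  have hA : discA g = ((g 0 0 + g 1 1) + Complex.I * (g 0 1 - g 1 0)) / 2 := by
    apply Complex.ext <;> simp [discA]
  have hB : discB g = ((g 0 0 - g 1 1) - Complex.I * (g 0 1 + g 1 0)) / 2 := by
    apply Complex.ext <;> simp [discB]
  have hnorm : ‖cayley z‖ ≤ 1 := by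
    rw [cayley, norm_div]
    refine div_le_one_of_le₀ ?_ (norm_nonneg _)
    rw [← sq_le_sq₀ (norm_nonneg _) (norm_nonneg _), ← Complex.normSq_eq_norm_sq,
      ← Complex.normSq_eq_norm_sq, Complex.normSq_apply, Complex.normSq_apply]
    simp
    nlinarith [z.im_pos]
  have hden := discMap_denom_ne_zero g hnorm
  have hI : Complex.I ^ 2 = -1 := Complex.I_sq
  rw [discMap, eq_div_iff hden]
  rw [cayley, div_mul_eq_mul_div, div_eq_iff hz', hA, hB, cayley]
  rw [UpperHalfPlane.coe_specialLinearGroup_apply]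
  simp only [Algebra.algebraMap_self, RingHom.id_apply, map_div₀, map_add, map_sub, map_mul,
    Complex.conj_I, Complex.conj_ofReal, map_ofNat]
  generalize (z : ℂ) = x at *
  generalize ((g 0 0 : ℝ) : ℂ) = a at *
  generalize ((g 0 1 : ℝ) : ℂ) = b at *
  generalize ((g 1 0 : ℝ) : ℂ) = c at *
  generalize ((g 1 1 : ℝ) : ℂ) = d at *
  obtain ⟨y, hy⟩ : ∃ y, y = (a * x + b) / (c * x + d) := ⟨_, rfl⟩
  rw [← hy]
  rw [eq_div_iff hd] at hy
  field_simp
  ring_nf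
  simp only [hI, show Complex.I ^ 3 = -Complex.I from Complex.I_pow_three]
  linear_combination 4 * Complex.I * hy

lemma norm_discMap (g : SL(2, ℝ)) (w : Circle) : ‖discMap g w‖ = 1 := by
  have hw : conj (w : ℂ) * w = 1 := by
    rw [← Complex.normSq_eq_conj_mul_self, Circle.normSq_coe, Complex.ofReal_one]
  have h : conj (discB g) * (w : ℂ) + conj (discA g) = conj (discA g * w + discB g) * w := by
    simp only [map_add, map_mul]
    linear_combination -(conj (discA g)) * hw
  have h0 := discMap_denom_ne_zero g (w := w) (Circle.norm_coe w).le
  rw [discMap, norm_div, div_eq_one_iff_eq (norm_ne_zero_iff.2 h0), h, norm_mul, Circle.norm_coe,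
    mul_one, Complex.norm_conj]

/-- The action of `g` on the circle at infinity `S¹`, the boundary of the unit disc. -/
def boundaryMap (g : SL(2, ℝ)) (w : Circle) : Circle :=
  ⟨discMap g w, mem_sphere_zero_iff_norm.2 (norm_discMap g w)⟩

/-! ### Quotient of finite area -/

/-- The orbifold `G \ ℍ` has finite area: there is a fundamental domain of finite hyperbolic area
(`volume` on `ℍ` is `dx dy / y ^ 2`) for the group of transformations of `ℍ` induced by `G`.
The induced group is used because `-1` acts trivially and may belong to `G`. -/
def HasFiniteCoarea (G : Subgroup SL(2, ℝ)) : Prop :=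
  ∃ F : Set ℍ, MeasureTheory.IsFundamentalDomain (MulAction.toPermHom G ℍ).range F
    MeasureTheory.volume ∧ MeasureTheory.volume F < ⊤

/-! ### Lyapunov expansion exponent -/

/-- The ball of radius `R` about `1` for the word metric of `S`: all products of at most `R`
elements of `S ∪ S⁻¹`. -/
def wordBall {Γ : Type*} [Group Γ] (S : Set Γ) (R : ℕ) : Set Γ :=
  {g | ∃ l : List Γ, l.length ≤ R ∧ (∀ s ∈ l, s ∈ S ∨ s⁻¹ ∈ S) ∧ l.prod = g}

/-- `|f'(p)|` for a map `f` of the circle, with respect to the angle `t` in `p * exp (i t)`: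
if `f (p * exp (i t)) = exp (i h(t))`, this is `|h'(0)|`. -/
def absDeriv (f : Circle → Circle) (p : Circle) : ℝ :=
  ‖deriv (fun t : ℝ => (f (p * Circle.exp t) : ℂ)) 0‖

/-- The Lyapunov expansion exponent at `p` of the group `Γ` with generating set `S` acting on the
circle by `act`, with values in `[-∞, ∞]`. -/
def lyapunovExpansionExponent {Γ : Type*} [Group Γ] (act : Γ → Circle → Circle) (S : Set Γ)
    (p : Circle) : EReal :=
  Filter.limsup
    (fun R : ℕ => ⨆ g ∈ wordBall S R, ((1 / (R : ℝ) * Real.log (absDeriv (act g) p) : ℝ) : EReal))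
    Filter.atTop

end Fuchsian

end

/-!
A boundary point is `h • ∞` for some `h ∈ SL(2, ℝ)`, and `log |g'|` at it is the change of
`-log (colSq · 0)` from `h` to `g h`. Suppose that it exceeds `ε` times the word length of `g`, by
arbitrarily large amounts, for a set of `h` of positive measure. The union of the `G`-translates of
this set is invariant under `G` on the left and under upper triangular matrices on the right, so it
is conull by Moore's ergodicity theorem.

Let `φ` be a bounded `G`-invariant function with `φ h ≤ exp (dist (h • i) i)` up to a constant.
Between its times of closest approach to `i` and to `g⁻¹ • i`, the geodesic from `h` collects an
integral of `φ` that is at most a constant `C` times the word length of `g`: each letter of `g`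
shifts the time of closest approach by an amount inversely proportional to `exp d`, where `d` is the
distance from the geodesic to `i`. On the other hand this stretch of the geodesic is longer than `ε`
times the word length. The maximal ergodic theorem for the geodesic flow therefore bounds the
average of `φ` by `C / ε`. Since `C` does not depend on `φ`, this fails for the truncations of the
exponential of the distance to the orbit `G • i`: this exponential is not integrable, because the
region at depth `d` in a cusp has area comparable to `exp (-d)`.
-/

namespace Fuchsian

open MeasureTheory Set Filter Topology
open scoped Pointwise

/-! ### Haar measure and homogeneous spaces -/

section Haar

variable {H : Type*} [Group H] [TopologicalSpace H] [IsTopologicalGroup H] [LocallyCompactSpace H]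

lemma modularCharacterFun_eq_one [Group.IsPerfect H] (g : H) :
    Measure.modularCharacterFun g = 1 := by
  have hg : g ∈ (Measure.modularCharacter : H →* NNReal).toHomUnits.ker :=
    Abelianization.commutator_subset_ker _ (by simp)
  exact congrArg Units.val hg

variable [SecondCountableTopology H] [MeasurableSpace H] [BorelSpace H] (η : Measure H)
  [η.IsHaarMeasure]

lemma isMulRightInvariant_of_isPerfect [Group.IsPerfect H] :
    η.IsMulRightInvariant := by
  refine ⟨fun g => ?_⟩
  rw [Measure.isMulLeftInvariant_eq_smul (Measure.map (· * g) η) η,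
    ← Measure.modularCharacterFun_eq_haarScalarFactor, modularCharacterFun_eq_one, one_smul]

lemma isInvInvariant_of_isMulRightInvariant [η.IsMulRightInvariant] :
    η.IsInvInvariant := by
  set c := Measure.haarScalarFactor η.inv η
  have hc : η.inv = c • η := Measure.isMulLeftInvariant_eq_smul _ _
  have hcc : η = (c ^ 2) • η := by
    conv_lhs => rw [← Measure.inv_inv η, hc]
    rw [Measure.inv, Measure.map_smul, ← Measure.inv, hc, smul_smul, pow_two]
  have K : TopologicalSpace.PositiveCompacts H := Classical.arbitrary _
  have hK : (c : ENNReal) ^ 2 * η K = 1 ^ 2 * η K := by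
    conv_rhs => rw [hcc]
    simp [ENNReal.smul_def]
  have hc_sq : (c : ENNReal) ^ 2 = 1 ^ 2 :=
    (ENNReal.mul_left_inj (Measure.measure_pos_of_nonempty_interior _ K.interior_nonempty).ne'
      K.isCompact.measure_lt_top.ne).1 hK
  have hc_one : (c : ENNReal) = 1 := (ENNReal.pow_right_strictMono two_ne_zero).injective hc_sq
  exact ⟨by rw [hc, show c = 1 by exact_mod_cast hc_one, one_smul]⟩

end Haar

section HomogeneousSpace

variable {H X : Type*} [Group H] [MeasurableSpace H] [MeasurableMul₂ H] [MeasurableInv H]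
  [MulAction H X] [MeasurableSpace X] [MeasurableSMul₂ H X] {η : Measure H}
  [η.IsMulRightInvariant] [η.IsInvInvariant] {ν : Measure X}

omit [MeasurableSpace X] [MeasurableSMul₂ H X] in
lemma measure_setOf_inv_smul_mem [MulAction.IsPretransitive H X] (w z : X) (E : Set X) :
    η {g : H | g⁻¹ • w ∈ E} = η {g : H | g • z ∈ E} := by
  obtain ⟨k, rfl⟩ := MulAction.exists_smul_eq H z w
  rw [← measure_preimage_mul_right η k {g : H | g • z ∈ E}, ← Measure.measure_preimage_inv]
  congr 1
  ext g
  simp [mul_smul]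

variable [MulAction.IsPretransitive H X] [SFinite η] [SFinite ν]

lemma lintegral_measure_inter_preimage_inv_smul (z : X) {E E' : Set X} (hE : MeasurableSet E)
    (hE' : MeasurableSet E') :
    ∫⁻ g : H, ν (E ∩ (g⁻¹ • ·) ⁻¹' E') ∂η = ν E * η {g : H | g • z ∈ E'} := by
  have hP : MeasurableSet {p : H × X | p.2 ∈ E ∧ p.1⁻¹ • p.2 ∈ E'} :=
    (measurable_snd hE).inter ((measurable_fst.inv.smul measurable_snd) hE')
  have fubini := (Measure.prod_apply (μ := η) (ν := ν) hP).symm.trans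
    (Measure.prod_apply_symm (μ := η) (ν := ν) hP)
  have hslice : ∀ w : X, η ((fun g : H => (g, w)) ⁻¹' {p : H × X | p.2 ∈ E ∧ p.1⁻¹ • p.2 ∈ E'}) =
      E.indicator (fun _ => η {g : H | g • z ∈ E'}) w := by
    intro w
    by_cases hw : w ∈ E
    · simpa [hw] using measure_setOf_inv_smul_mem w z E'
    · simp [hw]
  simp_rw [hslice] at fubini
  rw [lintegral_indicator_const hE, mul_comm] at fubini
  exact fubini

variable [SMulInvariantMeasure H X ν]

lemma measure_mul_measure_setOf_smul_mem (z : X) {E E' : Set X} (hE : MeasurableSet E)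
    (hE' : MeasurableSet E') :
    ν E * η {g : H | g • z ∈ E'} = ν E' * η {g : H | g • z ∈ E} := by
  rw [← lintegral_measure_inter_preimage_inv_smul z hE hE',
    ← lintegral_measure_inter_preimage_inv_smul z hE' hE, ← lintegral_inv_eq_self]
  refine lintegral_congr fun g => ?_
  rw [← measure_preimage_smul (μ := ν) g⁻¹]
  congr 1
  ext w
  simp [and_comm]

lemma exists_measure_setOf_smul_mem_eq_mul (hν : ν ≠ 0) (z : X) {B : Set X} (hB : MeasurableSet B)
    (hνB : ν B ≠ ⊤) (hηB : η {g : H | g • z ∈ B} ≠ 0) (hηB' : η {g : H | g • z ∈ B} ≠ ⊤) :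
    ∃ c ≠ ⊤, ∀ E : Set X, MeasurableSet E → η {g : H | g • z ∈ E} = c * ν E := by
  have hνB' : ν B ≠ 0 := by
    intro h0
    have := measure_mul_measure_setOf_smul_mem (η := η) (ν := ν) z MeasurableSet.univ hB
    rw [h0, zero_mul, mul_eq_zero, Measure.measure_univ_eq_zero] at this
    exact this.elim hν hηB
  refine ⟨η {g : H | g • z ∈ B} / ν B, ENNReal.div_ne_top hηB' hνB', fun E hE => ?_⟩
  rw [mul_comm, ← mul_div_assoc, measure_mul_measure_setOf_smul_mem z hE hB, mul_comm,
    ENNReal.mul_div_cancel_right hνB' hνB]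

end HomogeneousSpace

/-! ### The special linear group -/

section SpecialLinearGroup

variable {n R : Type*} [Fintype n] [DecidableEq n] [CommRing R] [TopologicalSpace R]

lemma continuous_entry (i j : n) :
    Continuous fun g : Matrix.SpecialLinearGroup n R => g i j :=
  (continuous_subtype_val : Continuous fun g : Matrix.SpecialLinearGroup n R =>
    (g : Matrix n n R)).matrix_elem i j

lemma continuous_of_continuous_entries {X : Type*} [TopologicalSpace X]
    {f : X → Matrix.SpecialLinearGroup n R} (h : ∀ i j, Continuous fun x => f x i j) :
    Continuous f :=
  Continuous.subtype_mk (continuous_matrix h) fun x => (f x).2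

variable [IsTopologicalRing R] [T1Space R]

instance [LocallyCompactSpace R] : LocallyCompactSpace (Matrix.SpecialLinearGroup n R) :=
  haveI : LocallyCompactSpace (Matrix n n R) := inferInstanceAs (LocallyCompactSpace (n → n → R))
  Matrix.SpecialLinearGroup.isClosedEmbedding_val.locallyCompactSpace

instance [SecondCountableTopology R] :
    SecondCountableTopology (Matrix.SpecialLinearGroup n R) :=
  haveI : SecondCountableTopology (Matrix n n R) :=
    inferInstanceAs (SecondCountableTopology (n → n → R))
  Matrix.SpecialLinearGroup.isClosedEmbedding_val.isEmbedding.secondCountableTopology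

end SpecialLinearGroup

/-- The upper unipotent matrix with entry `x`; right multiplication by these is the
contracting horocycle flow. -/
def upperUnipotent (x : ℝ) : SL(2, ℝ) := ⟨!![1, x; 0, 1], by simp⟩

/-- The lower unipotent matrix with entry `x`; right multiplication by these is the
expanding horocycle flow. -/
def lowerUnipotent (x : ℝ) : SL(2, ℝ) := ⟨!![1, 0; x, 1], by simp⟩

/-- The diagonal matrix with entries `exp (t / 2)` and `exp (-t / 2)`; right multiplication by it is
the time `t` map of the geodesic flow. -/
noncomputable def diagFlow (t : ℝ) : SL(2, ℝ) :=
  ⟨!![Real.exp (t / 2), 0; 0, Real.exp (-(t / 2))], by simp [← Real.exp_add]⟩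

lemma mul_entry (g h : SL(2, ℝ)) (i j : Fin 2) :
    (g * h) i j = g i 0 * h 0 j + g i 1 * h 1 j := by
  rw [Matrix.SpecialLinearGroup.coe_mul, Matrix.mul_apply, Fin.sum_univ_two]

lemma det_entries (g : SL(2, ℝ)) : g 0 0 * g 1 1 - g 0 1 * g 1 0 = 1 := by
  rw [← Matrix.det_fin_two, g.det_coe]

@[simp] lemma upperUnipotent_coe (x : ℝ) :
    (upperUnipotent x : Matrix (Fin 2) (Fin 2) ℝ) = !![1, x; 0, 1] := rfl

@[simp] lemma lowerUnipotent_coe (x : ℝ) :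
    (lowerUnipotent x : Matrix (Fin 2) (Fin 2) ℝ) = !![1, 0; x, 1] := rfl

@[simp] lemma diagFlow_coe (t : ℝ) : (diagFlow t : Matrix (Fin 2) (Fin 2) ℝ) =
    !![Real.exp (t / 2), 0; 0, Real.exp (-(t / 2))] := rfl

lemma continuous_lowerUnipotent : Continuous lowerUnipotent := by
  refine continuous_of_continuous_entries fun i j => ?_
  fin_cases i <;> fin_cases j <;> simp only [lowerUnipotent_coe] <;> fun_prop

lemma continuous_diagFlow : Continuous diagFlow := by
  refine continuous_of_continuous_entries fun i j => ?_
  fin_cases i <;> fin_cases j <;> simp only [diagFlow_coe] <;> fun_prop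

lemma lowerUnipotent_zero : lowerUnipotent 0 = 1 := by
  ext i j
  fin_cases i <;> fin_cases j <;> simp

lemma diagFlow_zero : diagFlow 0 = 1 := by
  ext i j
  fin_cases i <;> fin_cases j <;> simp

lemma diagFlow_add (s t : ℝ) : diagFlow (s + t) = diagFlow s * diagFlow t := by
  ext i j
  fin_cases i <;> fin_cases j <;>
    simp [-Matrix.SpecialLinearGroup.coe_mul, mul_entry, ← Real.exp_add, add_div, add_comm]

lemma diagFlow_mul_lowerUnipotent (t x : ℝ) :
    diagFlow t * lowerUnipotent x = lowerUnipotent (Real.exp (-t) * x) * diagFlow t := by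
  have h : Real.exp (-t) * x * Real.exp (t / 2) = Real.exp (-(t / 2)) * x := by
    rw [mul_right_comm, ← Real.exp_add]
    ring_nf
  ext i j
  fin_cases i <;> fin_cases j <;> simp [-Matrix.SpecialLinearGroup.coe_mul, mul_entry, h]

lemma unipotent_induction {P : SL(2, ℝ) → Prop} (upper : ∀ x, P (upperUnipotent x))
    (lower : ∀ x, P (lowerUnipotent x)) (mul : ∀ g h, P g → P h → P (g * h)) (g : SL(2, ℝ)) :
    P g := by
  refine Matrix.SL2.transvection_induction P (fun i j hij c => ?_) mul g
  have hcases : Matrix.SpecialLinearGroup.transvection hij c = upperUnipotent c ∨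
      Matrix.SpecialLinearGroup.transvection hij c = lowerUnipotent c := by
    rcases Fin.exists_fin_two.1 ⟨i, rfl⟩ with rfl | rfl <;>
      rcases Fin.exists_fin_two.1 ⟨j, rfl⟩ with rfl | rfl
    · exact absurd rfl hij
    · left
      ext a b
      fin_cases a <;> fin_cases b <;> simp [Matrix.SpecialLinearGroup.transvection_coe]
    · right
      ext a b
      fin_cases a <;> fin_cases b <;> simp [Matrix.SpecialLinearGroup.transvection_coe]
    · exact absurd rfl hij
  rcases hcases with h | h
  · exact h ▸ upper c
  · exact h ▸ lower c

instance : MeasurableSpace SL(2, ℝ) := borel _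

instance : BorelSpace SL(2, ℝ) := ⟨rfl⟩

/-- A Haar measure on `SL(2, ℝ)`. -/
noncomputable def haarSL : Measure SL(2, ℝ) := Measure.haar

instance : haarSL.IsHaarMeasure := by unfold haarSL; infer_instance

instance : haarSL.IsMulRightInvariant :=
  haveI : Group.IsPerfect SL(2, ℝ) :=
    ⟨Matrix.SL2.commutator_eq_top (a := 2) (by norm_num) (by norm_num)⟩
  isMulRightInvariant_of_isPerfect haarSL

instance : haarSL.IsInvInvariant := isInvInvariant_of_isMulRightInvariant haarSL

instance : SMulInvariantMeasure SL(2, ℝ) ℍ volume :=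
  ⟨fun g _ hs => measure_preimage_smul_of_nullMeasurableSet
    (G := GL (Fin 2) ℝ) (c := (g : GL (Fin 2) ℝ)) hs.nullMeasurableSet⟩

instance : MeasurableSMul₂ SL(2, ℝ) ℍ := ⟨continuous_smul.measurable⟩

lemma volume_upperHalfPlane_ne_zero : (volume : Measure ℍ) ≠ 0 := by
  have hopen := UpperHalfPlane.isOpenEmbedding_coe.isOpen_range
  refine fun h => (hopen.measure_pos volume (range_nonempty _)).ne' ?_
  have hzero : volume (univ : Set ℍ) = 0 := by simp [h]
  rw [UpperHalfPlane.volume_eq_lintegral, image_univ,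
    setLIntegral_eq_zero_iff hopen.measurableSet (by fun_prop)] at hzero
  refine measure_mono_null ?_ (ae_iff.1 hzero)
  rintro _ ⟨z, rfl⟩
  simp [z.im_pos, z.im_ne_zero]

lemma exists_haarSL_setOf_smul_mem_eq_mul (z : ℍ) :
    ∃ c ≠ ⊤, ∀ E : Set ℍ, MeasurableSet E → haarSL {g | g • z ∈ E} = c * volume E := by
  have hcompact : IsCompact (Metric.closedBall z 1) := isCompact_closedBall z 1
  refine exists_measure_setOf_smul_mem_eq_mul volume_upperHalfPlane_ne_zero z
    Metric.isClosed_closedBall.measurableSet hcompact.measure_lt_top.ne ?_ ?_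
  · refine (Measure.measure_pos_of_mem_nhds haarSL (x := 1) ?_).ne'
    exact (by fun_prop : Continuous fun g : SL(2, ℝ) => g • z).continuousAt.preimage_mem_nhds
      (by simpa using Metric.closedBall_mem_nhds z one_pos)
  · obtain ⟨k, rfl⟩ := MulAction.exists_smul_eq SL(2, ℝ) UpperHalfPlane.I z
    rw [show {g : SL(2, ℝ) | g • k • UpperHalfPlane.I ∈ Metric.closedBall (k • UpperHalfPlane.I) 1}
      = (· * k) ⁻¹' {g | g • UpperHalfPlane.I ∈ Metric.closedBall (k • UpperHalfPlane.I) 1} by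
        ext g; simp [mul_smul], measure_preimage_mul_right]
    exact (UpperHalfPlane.isProperMap_smul_I.isCompact_preimage hcompact).measure_lt_top.ne

lemma quasiMeasurePreserving_smul (z : ℍ) :
    Measure.QuasiMeasurePreserving (fun g : SL(2, ℝ) => g • z) haarSL volume := by
  have hm : Measurable fun g : SL(2, ℝ) => g • z := by fun_prop
  refine ⟨hm, Measure.AbsolutelyContinuous.mk fun E hE h0 => ?_⟩
  obtain ⟨c, -, hc⟩ := exists_haarSL_setOf_smul_mem_eq_mul z
  rw [Measure.map_apply hm hE]
  exact (hc E hE).trans (by rw [h0, mul_zero])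

/-! ### Invariant sets and covolume -/

/-- `E` is a union of right cosets `G g`, that is, the preimage of a subset of `G \ H`. -/
def IsLeftInvariantSet {H : Type*} [Group H] (G : Subgroup H) (E : Set H) : Prop :=
  ∀ γ ∈ G, ∀ g, γ * g ∈ E ↔ g ∈ E

/-- A finite measure `μ` on `H` that plays the role of the invariant measure of `G \ H` induced by
`η`: on left `G`-invariant sets it is right-invariant, and it dominates `η` there, up to the
multiplicity with which a set meets the `G`-cosets. Working with measures on `H` avoids the
measurable structure of the quotient. -/
structure IsCovolumeMeasure {H : Type*} [Group H] [MeasurableSpace H] (η : Measure H)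
    (G : Subgroup H) (μ : Measure H) : Prop where
  le : μ ≤ η
  lt_top : μ univ < ⊤
  preimage_mul_right : ∀ E, MeasurableSet E → IsLeftInvariantSet G E →
    ∀ h, μ ((· * h) ⁻¹' E) = μ E
  eq_zero : ∀ E, MeasurableSet E → IsLeftInvariantSet G E → μ E = 0 → η E = 0
  le_mul : ∀ B E (N : ℕ), MeasurableSet B → MeasurableSet E → IsLeftInvariantSet G E → B ⊆ E →
    (∀ g, {γ | γ ∈ G ∧ γ * g ∈ B}.encard ≤ N) → η B ≤ N * μ E

section FundamentalDomain

variable {H X : Type*} [Group H] [MulAction H X] {G : Subgroup H}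

instance [Countable G] : Countable (MulAction.toPermHom G X).range :=
  (MulAction.toPermHom G X).rangeRestrict_surjective.countable

lemma exists_mem_forall_smul_eq (σ : (MulAction.toPermHom G X).range) :
    ∃ γ ∈ G, ∀ z : X, σ • z = γ • z := by
  obtain ⟨_, γ, rfl⟩ := σ
  exact ⟨γ, γ.2, fun z => rfl⟩

variable [MeasurableSpace H] [MeasurableSpace X] [MeasurableSMul H X] {η : Measure H}
  {ν : Measure X}

instance : MeasurableConstSMul (MulAction.toPermHom G X).range X := by
  refine ⟨fun σ => ?_⟩
  obtain ⟨γ, -, hγ⟩ := exists_mem_forall_smul_eq σ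
  simp_rw [hγ]
  fun_prop

instance : MeasurableConstSMul (MulAction.toPermHom G X).range (X × X) :=
  ⟨fun σ => ((measurable_const_smul σ).comp measurable_fst).prodMk
    ((measurable_const_smul σ).comp measurable_snd)⟩

instance [SMulInvariantMeasure H X ν] :
    SMulInvariantMeasure (MulAction.toPermHom G X).range X ν := by
  refine ⟨fun σ s hs => ?_⟩
  obtain ⟨γ, -, hγ⟩ := exists_mem_forall_smul_eq σ
  simp_rw [hγ]
  exact SMulInvariantMeasure.measure_preimage_smul γ hs

variable [MeasurableMul H] [η.IsMulLeftInvariant]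

lemma smulInvariantMeasure_map_smul_prod {E : Set H} (hEG : IsLeftInvariantSet G E) (z w : X) :
    SMulInvariantMeasure (MulAction.toPermHom G X).range (X × X)
      ((η.restrict E).map fun g => (g • z, g • w)) := by
  have hm : Measurable fun g : H => (g • z, g • w) := by fun_prop
  refine ⟨fun σ s hs => ?_⟩
  obtain ⟨γ, hγG, hγ⟩ := exists_mem_forall_smul_eq σ
  have hσ : (fun p : X × X => σ • p) = fun p => γ • p := funext fun p => Prod.ext (hγ _) (hγ _)
  have hs' : MeasurableSet ((fun p : X × X => γ • p) ⁻¹' s) :=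
    (((measurable_const_smul γ).comp measurable_fst).prodMk
      ((measurable_const_smul γ).comp measurable_snd)) hs
  rw [hσ, Measure.map_apply hm hs', Measure.map_apply hm hs, Measure.restrict_apply (hm hs'),
    Measure.restrict_apply (hm hs),
    ← measure_preimage_mul η γ ((fun g => (g • z, g • w)) ⁻¹' s ∩ E)]
  congr 1
  ext g
  simp [mul_smul, hEG γ hγG g]

variable [Countable G] {F : Set X}

/- Both sides measure a fundamental domain of `X × X` for the measure of
`smulInvariantMeasure_map_smul_prod`, namely `F × X` and `X × F`. -/
lemma measure_restrict_setOf_smul_mem_eq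
    (hη : ∀ z : X, Measure.QuasiMeasurePreserving (fun g : H => g • z) η ν)
    (hF : IsFundamentalDomain (MulAction.toPermHom G X).range F ν)
    {E : Set H} (hEG : IsLeftInvariantSet G E) (z w : X) :
    η.restrict E {g | g • z ∈ F} = η.restrict E {g | g • w ∈ F} := by
  have hm : Measurable fun g : H => (g • z, g • w) := by fun_prop
  set ρ : Measure (X × X) := (η.restrict E).map fun g => (g • z, g • w) with hρ
  have hinv : SMulInvariantMeasure (MulAction.toPermHom G X).range (X × X) ρ :=
    smulInvariantMeasure_map_smul_prod hEG z w
  have hac : η.restrict E ≪ η := Measure.restrict_le_self.absolutelyContinuous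
  have hfst : Measure.QuasiMeasurePreserving (Prod.fst : X × X → X) ρ ν := by
    refine ⟨measurable_fst, ?_⟩
    rw [hρ, Measure.map_map measurable_fst hm]
    exact ((hη z).mono_left hac).absolutelyContinuous
  have hsnd : Measure.QuasiMeasurePreserving (Prod.snd : X × X → X) ρ ν := by
    refine ⟨measurable_snd, ?_⟩
    rw [hρ, Measure.map_map measurable_snd hm]
    exact ((hη w).mono_left hac).absolutelyContinuous
  have hF₁ := hF.preimage_of_equiv hfst (e := id) Function.bijective_id (fun σ p => rfl)
  have hF₂ := hF.preimage_of_equiv hsnd (e := id) Function.bijective_id (fun σ p => rfl)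
  have heq := hF₁.measure_eq hF₂
  rwa [hρ, Measure.map_apply₀ hm.aemeasurable (hρ ▸ hF₁.nullMeasurableSet),
    Measure.map_apply₀ hm.aemeasurable (hρ ▸ hF₂.nullMeasurableSet)] at heq

lemma measure_eq_tsum_restrict_setOf_smul_mem [SMulInvariantMeasure H X ν]
    (hη : ∀ z : X, Measure.QuasiMeasurePreserving (fun g : H => g • z) η ν)
    (hF : IsFundamentalDomain (MulAction.toPermHom G X).range F ν)
    {lift : (MulAction.toPermHom G X).range → H} (hlift : ∀ σ, ∀ z : X, σ • z = lift σ • z)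
    {B : Set H} (hB : MeasurableSet B) (z : X) :
    η B = ∑' σ, η.restrict {g | g • z ∈ F} ((lift σ * ·) ⁻¹' B) := by
  have hm : Measurable fun g : H => g • z := by fun_prop
  have hle : η.restrict B ≪ η := Measure.restrict_le_self.absolutelyContinuous
  have hac := ((hη z).mono_left hle).absolutelyContinuous
  have hsum := hF.lintegral_eq_tsum_of_ac hac (fun _ => 1)
  simp only [lintegral_const, one_mul, Measure.restrict_apply_univ,
    Measure.map_apply hm MeasurableSet.univ, preimage_univ] at hsum
  rw [hsum]
  refine tsum_congr fun σ => ?_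
  have hFσ : NullMeasurableSet (σ • F) ν := hF.nullMeasurableSet_smul σ
  rw [Measure.map_apply₀ hm.aemeasurable (hFσ.mono_ac hac), Measure.restrict_apply' hB,
    Measure.restrict_apply (measurable_const_mul (lift σ) hB), ← measure_preimage_mul η (lift σ)]
  congr 1
  ext g
  simp only [mem_preimage, mem_inter_iff, mem_ofPred_eq, mul_smul, ← hlift, smul_mem_smul_set_iff]
  tauto

omit [MeasurableSpace X] [MeasurableSMul H X] [MeasurableMul H] [Countable G] [MeasurableSpace H] in
lemma tsum_indicator_lift_mul_le {lift : (MulAction.toPermHom G X).range → H}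
    (hliftG : ∀ σ, lift σ ∈ G) (hlift : ∀ σ, ∀ z : X, σ • z = lift σ • z) {B E : Set H} {N : ℕ}
    (hEG : IsLeftInvariantSet G E) (hBE : B ⊆ E)
    (hN : ∀ g, {γ | γ ∈ G ∧ γ * g ∈ B}.encard ≤ N) (g : H) :
    ∑' σ, ((lift σ * ·) ⁻¹' B).indicator (1 : H → ENNReal) g ≤
      E.indicator (fun _ => (N : ENNReal)) g := by
  have hinj : Function.Injective lift := fun σ τ h =>
    Subtype.ext <| Equiv.ext fun w =>
      (hlift σ w).trans ((congrArg (· • w) h).trans (hlift τ w).symm)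
  by_cases hg : g ∈ E
  · have hcard : ENat.card {σ | lift σ * g ∈ B} ≤ N := by
      refine le_trans ?_ (hN g)
      rw [← ENat.card_coe_set_eq]
      refine ENat.card_le_card_of_injective (f := fun σ : {σ | lift σ * g ∈ B} =>
        (⟨lift σ, hliftG σ, σ.2⟩ : {γ | γ ∈ G ∧ γ * g ∈ B})) fun σ τ h => ?_
      exact Subtype.ext (hinj (congrArg Subtype.val h))
    calc ∑' σ, ((lift σ * ·) ⁻¹' B).indicator (1 : H → ENNReal) g
        = ∑' σ, {σ | lift σ * g ∈ B}.indicator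
            (1 : (MulAction.toPermHom G X).range → ENNReal) σ := rfl
      _ = ENat.card {σ | lift σ * g ∈ B} := by
          rw [← tsum_subtype]
          simp only [Pi.one_apply, ENNReal.tsum_one]
      _ ≤ E.indicator (fun _ => (N : ENNReal)) g := by
          rw [indicator_of_mem hg]
          exact_mod_cast hcard
  · rw [indicator_of_notMem hg]
    refine le_of_eq (ENNReal.tsum_eq_zero.2 fun σ => indicator_of_notMem (fun h => hg ?_) _)
    exact (hEG _ (hliftG σ) g).1 (hBE h)

theorem isCovolumeMeasure_restrict [SMulInvariantMeasure H X ν] [η.IsMulRightInvariant]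
    (hη : ∀ z : X, Measure.QuasiMeasurePreserving (fun g : H => g • z) η ν)
    (hF : IsFundamentalDomain (MulAction.toPermHom G X).range F ν) (z : X)
    (hfin : η {g | g • z ∈ F} < ⊤) : IsCovolumeMeasure η G (η.restrict {g | g • z ∈ F}) := by
  choose lift hliftG hlift using exists_mem_forall_smul_eq (G := G) (X := X)
  have hsum {B : Set H} (hB : MeasurableSet B) :=
    measure_eq_tsum_restrict_setOf_smul_mem hη hF hlift hB z
  refine ⟨Measure.restrict_le_self, by rwa [Measure.restrict_apply_univ], fun E hE hEG h => ?_,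
    fun E hE hEG h0 => ?_, fun B E N hB hE hEG hBE hN => ?_⟩
  · rw [Measure.restrict_apply (measurable_mul_const h hE), Measure.restrict_apply hE,
      ← measure_preimage_mul_right η h⁻¹]
    have hbase := measure_restrict_setOf_smul_mem_eq hη hF hEG (h⁻¹ • z) z
    rw [Measure.restrict_apply' hE, Measure.restrict_apply' hE] at hbase
    rw [inter_comm E, ← hbase]
    congr 1
    ext g
    simp [mul_smul, and_comm]
  · rw [hsum hE]
    refine ENNReal.tsum_eq_zero.2 fun σ => ?_
    rwa [show (lift σ * ·) ⁻¹' E = E from Set.ext fun g => hEG _ (hliftG σ) g]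
  · set μ := η.restrict {g | g • z ∈ F}
    have hmeas (σ) : MeasurableSet ((lift σ * ·) ⁻¹' B) := measurable_const_mul (lift σ) hB
    calc η B = ∑' σ, ∫⁻ g, ((lift σ * ·) ⁻¹' B).indicator 1 g ∂μ := by
          simp_rw [hsum hB, lintegral_indicator_one (hmeas _)]
      _ = ∫⁻ g, ∑' σ, ((lift σ * ·) ⁻¹' B).indicator 1 g ∂μ :=
          (lintegral_tsum fun σ => (measurable_one.indicator (hmeas σ)).aemeasurable).symm
      _ ≤ ∫⁻ g, E.indicator (fun _ => (N : ENNReal)) g ∂μ :=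
          lintegral_mono (tsum_indicator_lift_mul_le hliftG hlift hEG hBE hN)
      _ = N * μ E := lintegral_indicator_const hE _

end FundamentalDomain

lemma exists_isCovolumeMeasure {G : Subgroup SL(2, ℝ)} [Countable G] (hG : HasFiniteCoarea G) :
    ∃ μ, IsCovolumeMeasure haarSL G μ := by
  obtain ⟨F, hF, hvol⟩ := hG
  obtain ⟨c, hc, hcE⟩ := exists_haarSL_setOf_smul_mem_eq_mul UpperHalfPlane.I
  refine ⟨_, isCovolumeMeasure_restrict quasiMeasurePreserving_smul hF UpperHalfPlane.I ?_⟩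
  calc haarSL {g | g • UpperHalfPlane.I ∈ F}
      ≤ haarSL {g | g • UpperHalfPlane.I ∈ toMeasurable volume F} :=
        measure_mono fun g hg => subset_toMeasurable _ _ hg
    _ = c * volume F := by rw [hcE _ (measurableSet_toMeasurable _ _), measure_toMeasurable]
    _ < ⊤ := ENNReal.mul_lt_top hc.lt_top hvol

/-! ### Moore's ergodicity theorem -/

lemma IsLeftInvariantSet.diff {H : Type*} [Group H] {G : Subgroup H} {E E' : Set H}
    (h : IsLeftInvariantSet G E) (h' : IsLeftInvariantSet G E') :
    IsLeftInvariantSet G (E \ E') :=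
  fun γ hγ g => and_congr (h γ hγ g) (not_congr (h' γ hγ g))

lemma IsLeftInvariantSet.preimage_mul_right {H : Type*} [Group H] {G : Subgroup H} {E : Set H}
    (h : IsLeftInvariantSet G E) (k : H) : IsLeftInvariantSet G ((· * k) ⁻¹' E) :=
  fun γ hγ g => by simpa only [mem_preimage, mul_assoc] using h γ hγ (g * k)

lemma measure_diff_preimage_mul {H : Type*} [Group H] [MeasurableSpace H] [MeasurableMul H]
    {η : Measure H} [η.IsMulRightInvariant] {E : Set H} {g h : H} (hg : η (E \ (· * g) ⁻¹' E) = 0)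
    (hh : η (E \ (· * h) ⁻¹' E) = 0) : η (E \ (· * (g * h)) ⁻¹' E) = 0 := by
  refine measure_mono_null (t := (E \ (· * g) ⁻¹' E) ∪ (· * g) ⁻¹' (E \ (· * h) ⁻¹' E)) ?_
    (measure_union_null hg ((measure_preimage_mul_right η g _).trans hh))
  intro k hk
  by_cases hkg : k * g ∈ E
  · exact Or.inr ⟨hkg, fun hkgh => hk.2 (by simpa only [mem_preimage, mul_assoc] using hkgh)⟩
  · exact Or.inl ⟨hk.1, hkg⟩

section RightTranslation

variable {H : Type*} [Group H] [TopologicalSpace H] [IsTopologicalGroup H] [LocallyCompactSpace H]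
  [SecondCountableTopology H] [MeasurableSpace H] [BorelSpace H] {η : Measure H}
  [η.IsHaarMeasure] {E : Set H}

lemma measure_eq_zero_or_compl_of_forall_diff_preimage (hE : MeasurableSet E)
    (h : ∀ k, η (E \ (· * k) ⁻¹' E) = 0) : η E = 0 ∨ η Eᶜ = 0 := by
  rw [or_iff_not_imp_left]
  intro hE0
  set D : Set (H × H) := {p | p.2 ∈ E ∧ p.2 * p.1 ∉ E}
  have hD : MeasurableSet D :=
    (measurable_snd hE).inter ((measurable_snd.mul measurable_fst) hE.compl)
  have hD0 : (η.prod η) D = 0 := (Measure.measure_prod_null hD).2 (ae_of_all _ h)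
  rw [Measure.prod_apply_symm hD, lintegral_eq_zero_iff (measurable_measure_prodMk_right hD)] at hD0
  obtain ⟨g, hgE, hg⟩ : ∃ g ∈ E, η ((fun k => (k, g)) ⁻¹' D) = 0 := by
    by_contra! hpos
    exact hE0 (measure_mono_null hpos hD0)
  rw [← measure_preimage_mul η g]
  refine measure_mono_null (fun k hk => ?_) hg
  exact ⟨hgE, hk⟩

variable [η.IsMulRightInvariant] {G : Subgroup H} {μ : Measure H}

lemma tendsto_measure_symmDiff_preimage_mul_right (hE : MeasurableSet E) (hE' : η E ≠ ⊤) :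
    Tendsto (fun h => η (symmDiff ((· * h) ⁻¹' E) E)) (𝓝 1) (𝓝 0) := by
  let R : H → C(H, H) := fun h => ⟨(· * h), continuous_mul_const h⟩
  have hR : Continuous R := ContinuousMap.continuous_of_continuous_uncurry _
    (by simpa [R, Function.uncurry_def] using! continuous_snd.mul continuous_fst)
  simpa [R] using! tendsto_measure_symmDiff_preimage_nhds_zero (μ := η) (ν := η)
    hR.continuousAt (Eventually.of_forall fun h => measurePreserving_mul_right η h)
    (measurePreserving_mul_right η 1) hE.nullMeasurableSet hE'

lemma tendsto_measure_compl_compactCovering [T2Space H] [IsFiniteMeasure μ] :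
    Tendsto (fun n => μ (compactCovering H n)ᶜ) atTop (𝓝 0) := by
  have h := tendsto_measure_iInter_atTop (μ := μ) (s := fun n => (compactCovering H n)ᶜ)
    (fun n => (isCompact_compactCovering H n).measurableSet.compl.nullMeasurableSet)
    (fun m n hmn => compl_subset_compl.2 (compactCovering_subset H hmn))
    ⟨0, measure_ne_top _ _⟩
  rwa [← compl_iUnion, iUnion_compactCovering, compl_univ, measure_empty] at h

lemma IsCovolumeMeasure.tendsto_diff_preimage_mul_right [T2Space H]
    (hμ : IsCovolumeMeasure η G μ) (hE : MeasurableSet E) :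
    Tendsto (fun h => μ (E \ (· * h) ⁻¹' E)) (𝓝 1) (𝓝 0) := by
  have hfinite : IsFiniteMeasure μ := ⟨hμ.lt_top⟩
  rw [ENNReal.tendsto_nhds_zero]
  intro ε hε
  have hε2 : 0 < ε / 2 := ENNReal.half_pos hε.ne'
  obtain ⟨n, hn⟩ :=
    (ENNReal.tendsto_nhds_zero.1 (tendsto_measure_compl_compactCovering (μ := μ)) _ hε2).exists
  obtain ⟨V, hV, hV1⟩ := exists_compact_mem_nhds (1 : H)
  set K := compactCovering H n
  have hKV : IsCompact (K * V) := (isCompact_compactCovering H n).mul hV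
  have hlocal := tendsto_measure_symmDiff_preimage_mul_right (η := η)
    (hE.inter hKV.measurableSet) (measure_inter_lt_top_of_right_ne_top hKV.measure_ne_top).ne
  filter_upwards [ENNReal.tendsto_nhds_zero.1 hlocal _ hε2] with h hh
  have hsub : E \ (· * h) ⁻¹' E ⊆
      Kᶜ ∪ symmDiff ((· * h) ⁻¹' (E ∩ (K * V))) (E ∩ (K * V)) := by
    intro g hg
    by_cases hgK : g ∈ K
    · exact Or.inr (Or.inr ⟨⟨hg.1, g, hgK, 1, mem_of_mem_nhds hV1, mul_one g⟩,
        fun hgh => hg.2 hgh.1⟩)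
    · exact Or.inl hgK
  calc μ (E \ (· * h) ⁻¹' E)
      ≤ μ Kᶜ + η (symmDiff ((· * h) ⁻¹' (E ∩ (K * V))) (E ∩ (K * V))) :=
        (measure_mono hsub).trans
          ((measure_union_le _ _).trans (add_le_add_right (hμ.le _) _))
    _ ≤ ε / 2 + ε / 2 := add_le_add hn hh
    _ = ε := ENNReal.add_halves ε

/- Mautner's phenomenon: by invariance `E \ E h⁻¹` has the same measure as the set obtained from the
conjugates of `h` by `a t`, and this measure is continuous at `h = 1`. -/
lemma IsCovolumeMeasure.measure_diff_preimage_eq_zero [T2Space H] (hμ : IsCovolumeMeasure η G μ)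
    (hE : MeasurableSet E) (hEG : IsLeftInvariantSet G E) {a : ℝ → H}
    (ha : ∀ t g, g * a t ∈ E ↔ g ∈ E) {h : H}
    (hlim : Tendsto (fun t => a t * h * (a t)⁻¹) atTop (𝓝 1)) :
    η (E \ (· * h) ⁻¹' E) = 0 := by
  have hmeas : MeasurableSet (E \ (· * h) ⁻¹' E) := hE.diff (measurable_mul_const h hE)
  have hinv : IsLeftInvariantSet G (E \ (· * h) ⁻¹' E) := hEG.diff (hEG.preimage_mul_right h)
  have hconst : ∀ t, μ (E \ (· * (a t * h * (a t)⁻¹)) ⁻¹' E) = μ (E \ (· * h) ⁻¹' E) := by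
    intro t
    rw [← hμ.preimage_mul_right _ hmeas hinv (a t)]
    congr 1
    ext g
    have hconj : g * (a t * h * (a t)⁻¹) * a t = g * a t * h := by group
    simp only [Set.mem_sdiff, mem_preimage]
    rw [ha, ← ha t (g * (a t * h * (a t)⁻¹)), hconj]
  have h0 := (hμ.tendsto_diff_preimage_mul_right hE).comp hlim
  simp only [Function.comp_def, hconst] at h0
  exact hμ.eq_zero _ hmeas hinv (tendsto_nhds_unique tendsto_const_nhds h0)

end RightTranslation

lemma IsCovolumeMeasure.haarSL_eq_zero_or_compl {G : Subgroup SL(2, ℝ)} {μ : Measure SL(2, ℝ)}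
    {E : Set SL(2, ℝ)} (hμ : IsCovolumeMeasure haarSL G μ) (hE : MeasurableSet E)
    (hEG : IsLeftInvariantSet G E) (hu : ∀ x g, g * upperUnipotent x ∈ E ↔ g ∈ E)
    (ha : ∀ t g, g * diagFlow t ∈ E ↔ g ∈ E) : haarSL E = 0 ∨ haarSL Eᶜ = 0 := by
  refine measure_eq_zero_or_compl_of_forall_diff_preimage hE fun h => ?_
  induction h using unipotent_induction with
  | upper x => simp [show (· * upperUnipotent x) ⁻¹' E = E from Set.ext (hu x)]
  | lower x =>
    refine hμ.measure_diff_preimage_eq_zero hE hEG ha ?_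
    simp only [diagFlow_mul_lowerUnipotent, mul_inv_cancel_right]
    rw [← lowerUnipotent_zero]
    refine (continuous_lowerUnipotent.tendsto 0).comp ?_
    simpa only [zero_mul] using Real.tendsto_exp_neg_atTop_nhds_zero.mul_const x
  | mul g h hg hh => exact measure_diff_preimage_mul hg hh

/-! ### The maximal ergodic theorem -/

section MaximalErgodic

variable {α : Type*} {T : α → α} {f : α → ℝ}

lemma partialSups_birkhoffSum_nonneg (n : ℕ) (x : α) : 0 ≤ partialSups (birkhoffSum T f) n x := by
  simpa only [birkhoffSum_zero] using le_partialSups_of_le (birkhoffSum T f) (Nat.zero_le n) x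

lemma partialSups_birkhoffSum_le_max (n : ℕ) (x : α) :
    partialSups (birkhoffSum T f) n x ≤
      max 0 (f x + partialSups (birkhoffSum T f) n (T x)) := by
  rw [Pi.partialSups_apply]
  refine partialSups_le _ _ _ fun k hk => ?_
  cases k with
  | zero => exact (birkhoffSum_zero T f x).le.trans (le_max_left _ _)
  | succ k =>
    rw [birkhoffSum_succ']
    exact le_max_of_le_right
      (add_le_add_right (le_partialSups_of_le (birkhoffSum T f) (Nat.le_of_succ_le hk) (T x)) _)

lemma partialSups_birkhoffSum_sub_comp_le (n : ℕ) (x : α) :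
    partialSups (birkhoffSum T f) n x - partialSups (birkhoffSum T f) n (T x) ≤
      {y | 0 < partialSups (birkhoffSum T f) n y}.indicator f x := by
  by_cases hx : 0 < partialSups (birkhoffSum T f) n x
  · rw [indicator_of_mem (show x ∈ {y | 0 < partialSups (birkhoffSum T f) n y} from hx),
      sub_le_iff_le_add]
    exact (le_max_iff.1 (partialSups_birkhoffSum_le_max n x)).resolve_left hx.not_ge
  · rw [indicator_of_notMem (show x ∉ {y | 0 < partialSups (birkhoffSum T f) n y} from hx)]
    linarith [partialSups_birkhoffSum_nonneg (T := T) (f := f) n (T x)]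

lemma exists_partialSups_birkhoffSum_pos_iff (x : α) :
    (∃ n, 0 < partialSups (birkhoffSum T f) n x) ↔ ∃ n, 0 < birkhoffSum T f n x := by
  refine ⟨fun ⟨n, hn⟩ => ?_, fun ⟨n, hn⟩ => ⟨n, hn.trans_le (le_partialSups (birkhoffSum T f) n x)⟩⟩
  rw [Pi.partialSups_apply] at hn
  obtain ⟨k, -, hk⟩ := exists_partialSups_eq (birkhoffSum T f · x) n
  exact ⟨k, hk ▸ hn⟩

variable {m : MeasurableSpace α} {μ : Measure α}

lemma measurable_birkhoffSum (hT : Measurable T) (hf : Measurable f) (n : ℕ) :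
    Measurable (birkhoffSum T f n) :=
  Finset.measurable_fun_sum _ fun k _ => hf.comp (hT.iterate k)

lemma measurableSet_exists_birkhoffSum_pos (hT : Measurable T) (hf : Measurable f) :
    MeasurableSet {x | ∃ n, 0 < birkhoffSum T f n x} := by
  rw [ofPred_exists]
  exact .iUnion fun n => measurableSet_lt measurable_const (measurable_birkhoffSum hT hf n)

lemma measurable_partialSups_birkhoffSum (hT : Measurable T) (hf : Measurable f) (n : ℕ) :
    Measurable (partialSups (birkhoffSum T f) n) := by
  induction n with
  | zero => exact measurable_birkhoffSum hT hf 0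
  | succ n ih =>
    rw [partialSups_add_one]
    exact ih.sup (measurable_birkhoffSum hT hf (n + 1))

lemma integrable_partialSups_birkhoffSum (hT : MeasurePreserving T μ μ) (hf : Integrable f μ)
    (n : ℕ) : Integrable (partialSups (birkhoffSum T f) n) μ := by
  have hsum : ∀ k, Integrable (birkhoffSum T f k) μ := fun k =>
    integrable_finsetSum _ fun j _ => (hT.iterate j).integrable_comp_of_integrable hf
  induction n with
  | zero => exact hsum 0
  | succ n ih =>
    rw [partialSups_add_one]
    exact ih.sup (hsum (n + 1))

lemma integral_comp_of_measurePreserving (hT : MeasurePreserving T μ μ)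
    (hf : AEStronglyMeasurable f μ) : ∫ x, f (T x) ∂μ = ∫ x, f x ∂μ := by
  rw [← integral_map hT.aemeasurable (by rwa [hT.map_eq]), hT.map_eq]

lemma setIntegral_exists_birkhoffSum_pos_nonneg (hT : MeasurePreserving T μ μ) (hfm : Measurable f)
    (hf : Integrable f μ) : 0 ≤ ∫ x in {x | ∃ n, 0 < birkhoffSum T f n x}, f x ∂μ := by
  set M := partialSups (birkhoffSum T f)
  have hmeas : ∀ n, MeasurableSet {x | 0 < M n x} := fun n =>
    measurableSet_lt measurable_const (measurable_partialSups_birkhoffSum hT.measurable hfm n)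
  have hstep : ∀ n, 0 ≤ ∫ x in {x | 0 < M n x}, f x ∂μ := by
    intro n
    have hint := integrable_partialSups_birkhoffSum hT hf n
    have hintT := hT.integrable_comp_of_integrable hint
    calc 0 = ∫ x, (M n x - M n (T x)) ∂μ := by
          rw [← sub_self (∫ x, M n x ∂μ)]
          nth_rewrite 2 [← integral_comp_of_measurePreserving hT hint.1]
          exact (integral_sub hint hintT).symm
      _ ≤ ∫ x, {x | 0 < M n x}.indicator f x ∂μ :=
        integral_mono (hint.sub hintT) (hf.indicator (hmeas n))
          (partialSups_birkhoffSum_sub_comp_le n)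
      _ = ∫ x in {x | 0 < M n x}, f x ∂μ := integral_indicator (hmeas n)
  have hmono : Monotone fun n => {x | 0 < M n x} :=
    fun m n hmn x hx => lt_of_lt_of_le hx (M.mono hmn x)
  have hunion : {x | ∃ n, 0 < birkhoffSum T f n x} = ⋃ n, {x | 0 < M n x} := by
    ext x
    simpa using (exists_partialSups_birkhoffSum_pos_iff x).symm
  rw [hunion]
  exact ge_of_tendsto' (tendsto_setIntegral_of_monotone hmeas hmono hf.integrableOn) hstep

end MaximalErgodic

section LeftInvariantSpace

variable {H : Type*} [Group H] [MeasurableSpace H] {G : Subgroup H}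

/-- The σ-algebra of measurable left `G`-invariant sets, which stands for the Borel σ-algebra of
`G \ H`. -/
abbrev leftInvariantSpace (G : Subgroup H) : MeasurableSpace H where
  MeasurableSet' E := MeasurableSet E ∧ IsLeftInvariantSet G E
  measurableSet_empty := ⟨.empty, fun _ _ _ => Iff.rfl⟩
  measurableSet_compl _ hE := ⟨hE.1.compl, fun γ hγ g => not_congr (hE.2 γ hγ g)⟩
  measurableSet_iUnion E hE := ⟨.iUnion fun i => (hE i).1, fun γ hγ g => by
    simp only [mem_iUnion, (hE _).2 γ hγ g]⟩

lemma leftInvariantSpace_le : leftInvariantSpace G ≤ ‹MeasurableSpace H› := fun _ hE => hE.1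

lemma measurable_leftInvariantSpace {β : Type*} [MeasurableSpace β] {f : H → β} (hf : Measurable f)
    (hfG : ∀ γ ∈ G, ∀ g, f (γ * g) = f g) : Measurable[leftInvariantSpace G] f :=
  fun s hs => ⟨hf hs, fun γ hγ g => by simp only [mem_preimage, hfG γ hγ g]⟩

variable {η μ : Measure H}

lemma measurable_mul_right_leftInvariantSpace [MeasurableMul H] (h : H) :
    Measurable[leftInvariantSpace G, leftInvariantSpace G] (· * h) :=
  fun _ hE => ⟨measurable_mul_const h hE.1, hE.2.preimage_mul_right h⟩

lemma IsCovolumeMeasure.measurePreserving_mul_right [MeasurableMul H] (hμ : IsCovolumeMeasure η G μ)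
    (h : H) :
    @MeasurePreserving _ _ (leftInvariantSpace G) (leftInvariantSpace G) (· * h)
      (μ.trim leftInvariantSpace_le) (μ.trim leftInvariantSpace_le) := by
  have hm := measurable_mul_right_leftInvariantSpace (G := G) h
  refine @MeasurePreserving.mk _ _ (leftInvariantSpace G) (leftInvariantSpace G) _ _ _ hm ?_
  refine @Measure.ext _ (leftInvariantSpace G) _ _ fun E hE => ?_
  rw [Measure.map_apply hm hE, trim_measurableSet_eq _ (hm hE), trim_measurableSet_eq _ hE,
    hμ.preimage_mul_right E hE.1 hE.2]

lemma IsCovolumeMeasure.integral_comp_mul_right [MeasurableMul H] (hμ : IsCovolumeMeasure η G μ)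
    {f : H → ℝ} (hf : Measurable f) (hfG : ∀ γ ∈ G, ∀ g, f (γ * g) = f g) (h : H) :
    ∫ g, f (g * h) ∂μ = ∫ g, f g ∂μ := by
  have hT := hμ.measurePreserving_mul_right h
  have hf' := (measurable_leftInvariantSpace hf hfG).stronglyMeasurable
  rw [integral_trim leftInvariantSpace_le hf',
    ← integral_comp_of_measurePreserving hT hf'.aestronglyMeasurable]
  refine integral_trim leftInvariantSpace_le (Measurable.stronglyMeasurable ?_)
  exact measurable_leftInvariantSpace (hf.comp (measurable_mul_const h)) fun γ hγ g => by
    simp only [mul_assoc, hfG γ hγ]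

lemma IsCovolumeMeasure.integral_nonneg_of_birkhoffSum_pos [MeasurableMul H]
    (hμ : IsCovolumeMeasure η G μ) {f : H → ℝ} (hf : Measurable f)
    (hfG : ∀ γ ∈ G, ∀ g, f (γ * g) = f g) (hfi : Integrable f μ) (h : H)
    (hpos : ∀ᵐ g ∂μ, ∃ n, 0 < birkhoffSum (· * h) f n g) : 0 ≤ ∫ g, f g ∂μ := by
  have hT := hμ.measurePreserving_mul_right h
  have hf' := measurable_leftInvariantSpace hf hfG
  have hmax := setIntegral_exists_birkhoffSum_pos_nonneg hT hf'
    (hfi.trim leftInvariantSpace_le hf'.stronglyMeasurable)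
  rw [← setIntegral_trim leftInvariantSpace_le hf'.stronglyMeasurable
      (measurableSet_exists_birkhoffSum_pos (measurable_mul_right_leftInvariantSpace h) hf'),
    setIntegral_congr_set (eventuallyEq_univ.2 hpos), setIntegral_univ] at hmax
  exact hmax

end LeftInvariantSpace

/-! ### Columns and heights -/

/-- The squared Euclidean norm of the `j`-th column of `m`. For `j = 0` it is the angular derivative
of `m⁻¹` at the boundary point `m • ∞`. -/
def colSq (m : SL(2, ℝ)) (j : Fin 2) : ℝ := m 0 j ^ 2 + m 1 j ^ 2

/-- The squared Frobenius norm of `m`, which is `2 cosh (dist (m • i) i)`. -/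
def frobSq (m : SL(2, ℝ)) : ℝ := colSq m 0 + colSq m 1

/-- The logarithm of the modulus of `m⁻¹ • i`: the time at which the geodesic `t ↦ m a_t • i` is
closest to `i`. -/
noncomputable def logModulus (m : SL(2, ℝ)) : ℝ := (Real.log (colSq m 1) - Real.log (colSq m 0)) / 2

lemma continuous_colSq (j : Fin 2) : Continuous fun m => colSq m j :=
  ((continuous_entry 0 j).pow 2).add ((continuous_entry 1 j).pow 2)

lemma colSq_nonneg (m : SL(2, ℝ)) (j : Fin 2) : 0 ≤ colSq m j := by
  unfold colSq
  positivity

lemma one_le_colSq_mul_colSq (m : SL(2, ℝ)) : 1 ≤ colSq m 0 * colSq m 1 := by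
  have hlagrange : colSq m 0 * colSq m 1 =
      (m 0 0 * m 1 1 - m 0 1 * m 1 0) ^ 2 + (m 0 0 * m 0 1 + m 1 0 * m 1 1) ^ 2 := by
    unfold colSq
    ring
  rw [hlagrange, det_entries]
  linarith [sq_nonneg (m 0 0 * m 0 1 + m 1 0 * m 1 1)]

lemma colSq_pos (m : SL(2, ℝ)) (j : Fin 2) : 0 < colSq m j := by
  have h := zero_lt_one.trans_le (one_le_colSq_mul_colSq m)
  fin_cases j
  exacts [pos_of_mul_pos_left h (colSq_nonneg m 1), pos_of_mul_pos_right h (colSq_nonneg m 0)]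

lemma two_le_frobSq (m : SL(2, ℝ)) : 2 ≤ frobSq m := by
  have h := one_le_colSq_mul_colSq m
  unfold frobSq
  nlinarith [sq_nonneg (colSq m 0 - colSq m 1), colSq_nonneg m 0, colSq_nonneg m 1]

lemma frobSq_inv (m : SL(2, ℝ)) : frobSq m⁻¹ = frobSq m := by
  rw [Matrix.SpecialLinearGroup.SL2_inv_expl]
  simp [frobSq, colSq]
  ring

lemma colSq_mul_le (s m : SL(2, ℝ)) (j : Fin 2) : colSq (s * m) j ≤ frobSq s * colSq m j := by
  simp only [colSq, frobSq, mul_entry]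
  nlinarith [sq_nonneg (s 0 0 * m 1 j - s 0 1 * m 0 j), sq_nonneg (s 1 0 * m 1 j - s 1 1 * m 0 j)]

lemma colSq_le_mul (s m : SL(2, ℝ)) (j : Fin 2) : colSq m j ≤ frobSq s * colSq (s * m) j := by
  have := colSq_mul_le s⁻¹ (s * m) j
  rwa [inv_mul_cancel_left, frobSq_inv] at this

lemma colSq_mul_sub_colSq_mul_eq (s m : SL(2, ℝ)) :
    colSq (s * m) 1 * colSq m 0 - colSq (s * m) 0 * colSq m 1 =
      (colSq s 1 - colSq s 0) * (m 0 0 * m 1 1 + m 0 1 * m 1 0) +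
        2 * (s 0 0 * s 0 1 + s 1 0 * s 1 1) * (m 0 0 * m 0 1 - m 1 0 * m 1 1) := by
  simp only [colSq, mul_entry]
  linear_combination ((s 0 1 ^ 2 + s 1 1 ^ 2 - s 0 0 ^ 2 - s 1 0 ^ 2) *
    (m 0 0 * m 1 1 + m 0 1 * m 1 0) + 2 * (s 0 0 * s 0 1 + s 1 0 * s 1 1) *
      (m 0 0 * m 0 1 - m 1 0 * m 1 1)) * det_entries m

lemma abs_colSq_mul_sub_colSq_mul_le (s m : SL(2, ℝ)) :
    |colSq (s * m) 1 * colSq m 0 - colSq (s * m) 0 * colSq m 1| ≤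
      2 * frobSq s * √(colSq m 0 * colSq m 1) := by
  have hdiag : |colSq s 1 - colSq s 0| ≤ frobSq s := by
    rw [abs_le, frobSq]
    constructor <;> linarith [colSq_nonneg s 0, colSq_nonneg s 1]
  have hoff : |2 * (s 0 0 * s 0 1 + s 1 0 * s 1 1)| ≤ frobSq s := by
    rw [abs_le, frobSq, colSq, colSq]
    constructor <;> nlinarith [sq_nonneg (s 0 0 + s 0 1), sq_nonneg (s 1 0 + s 1 1),
      sq_nonneg (s 0 0 - s 0 1), sq_nonneg (s 1 0 - s 1 1)]
  have hperm : |m 0 0 * m 1 1 + m 0 1 * m 1 0| ≤ √(colSq m 0 * colSq m 1) := by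
    refine Real.abs_le_sqrt ?_
    simp only [colSq]
    nlinarith [sq_nonneg (m 0 0 * m 0 1 - m 1 0 * m 1 1)]
  have hcross : |m 0 0 * m 0 1 - m 1 0 * m 1 1| ≤ √(colSq m 0 * colSq m 1) := by
    refine Real.abs_le_sqrt ?_
    simp only [colSq]
    nlinarith [sq_nonneg (m 0 0 * m 1 1 + m 1 0 * m 0 1)]
  have hN := (abs_nonneg _).trans hdiag
  rw [colSq_mul_sub_colSq_mul_eq]
  refine (abs_add_le _ _).trans ?_
  rw [abs_mul, abs_mul]
  linarith [mul_le_mul hdiag hperm (abs_nonneg _) hN, mul_le_mul hoff hcross (abs_nonneg _) hN]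

lemma log_sub_log_le_div {x y : ℝ} (hx : 0 < x) (hy : 0 < y) :
    Real.log y - Real.log x ≤ (y - x) / x := by
  rw [← Real.log_div hy.ne' hx.ne', sub_div, div_self hx.ne']
  exact Real.log_le_sub_one_of_pos (div_pos hy hx)

lemma log_sub_log_le_of_sub_le {x y N r : ℝ} (hx : 0 < x) (hy : 0 < y) (hN : 0 ≤ N) (hr : 0 < r)
    (hsub : y - x ≤ 2 * N * r) (hle : r * r ≤ N * x) :
    Real.log y - Real.log x ≤ 2 * (N ^ 2 / r) :=
  calc Real.log y - Real.log x ≤ (y - x) / x := log_sub_log_le_div hx hy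
    _ ≤ 2 * N * r / x := by gcongr
    _ = 2 * N * (r * r) / (r * x) := by field_simp
    _ ≤ 2 * N * (N * x) / (r * x) := by gcongr
    _ = 2 * (N ^ 2 / r) := by field_simp

lemma abs_logModulus_mul_sub_le (s m : SL(2, ℝ)) :
    |logModulus (s * m) - logModulus m| ≤ frobSq s ^ 2 / √(colSq m 0 * colSq m 1) := by
  have hA := colSq_pos m 0
  have hB := colSq_pos m 1
  have hA' := colSq_pos (s * m) 0
  have hB' := colSq_pos (s * m) 1
  have hr := Real.sqrt_pos.2 (mul_pos hA hB)
  have hr2 := Real.mul_self_sqrt (mul_pos hA hB).le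
  have hN : 0 ≤ frobSq s := two_pos.le.trans (two_le_frobSq s)
  have hcross := abs_le.1 (abs_colSq_mul_sub_colSq_mul_le s m)
  have hup := log_sub_log_le_of_sub_le (mul_pos hA' hB) (mul_pos hB' hA) hN hr (by linarith) <| by
    rw [hr2, ← mul_assoc]
    gcongr
    exact colSq_le_mul s m 0
  have hdown := log_sub_log_le_of_sub_le (mul_pos hB' hA) (mul_pos hA' hB) hN hr (by linarith) <| by
    rw [hr2, mul_comm (colSq m 0), ← mul_assoc]
    gcongr
    exact colSq_le_mul s m 1
  rw [Real.log_mul hA'.ne' hB.ne', Real.log_mul hB'.ne' hA.ne'] at hup hdown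
  rw [abs_le, logModulus, logModulus]
  constructor <;> linarith

lemma neg_log_colSq_le_logModulus (m : SL(2, ℝ)) : -Real.log (colSq m 0) ≤ logModulus m := by
  have h := Real.log_nonneg (one_le_colSq_mul_colSq m)
  rw [Real.log_mul (colSq_pos m 0).ne' (colSq_pos m 1).ne'] at h
  unfold logModulus
  linarith

lemma colSq_mul_diagFlow_zero (m : SL(2, ℝ)) (t : ℝ) :
    colSq (m * diagFlow t) 0 = Real.exp t * colSq m 0 := by
  have h : Real.exp t = Real.exp (t / 2) ^ 2 := by rw [← Real.exp_nat_mul]; ring_nf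
  simp [colSq, -Matrix.SpecialLinearGroup.coe_mul, mul_entry, h]
  ring

lemma colSq_mul_diagFlow_one (m : SL(2, ℝ)) (t : ℝ) :
    colSq (m * diagFlow t) 1 = Real.exp (-t) * colSq m 1 := by
  have h : Real.exp (-t) = Real.exp (-(t / 2)) ^ 2 := by rw [← Real.exp_nat_mul]; ring_nf
  simp [colSq, -Matrix.SpecialLinearGroup.coe_mul, mul_entry, h]
  ring

lemma frobSq_mul_diagFlow_eq (m : SL(2, ℝ)) (t : ℝ) :
    frobSq (m * diagFlow t) = √(colSq m 0 * colSq m 1) *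
      (Real.exp (t - logModulus m) + Real.exp (-(t - logModulus m))) := by
  have hA := colSq_pos m 0
  have hB := colSq_pos m 1
  have hsqrt : √(colSq m 0 * colSq m 1) =
      Real.exp ((Real.log (colSq m 0) + Real.log (colSq m 1)) / 2) := by
    rw [← Real.log_mul hA.ne' hB.ne', ← Real.log_sqrt (by positivity),
      Real.exp_log (Real.sqrt_pos.2 (by positivity))]
  rw [frobSq, colSq_mul_diagFlow_zero, colSq_mul_diagFlow_one, hsqrt, mul_add, ← Real.exp_add,
    ← Real.exp_add, logModulus]
  conv_lhs => rw [← Real.exp_log hA, ← Real.exp_log hB, ← Real.exp_add, ← Real.exp_add]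
  ring_nf

lemma frobSq_mul_diagFlow_le (m : SL(2, ℝ)) {t κ : ℝ} (ht : |t - logModulus m| ≤ κ) :
    frobSq (m * diagFlow t) ≤ 2 * √(colSq m 0 * colSq m 1) * Real.exp κ := by
  obtain ⟨hlow, hup⟩ := abs_le.1 ht
  rw [frobSq_mul_diagFlow_eq, mul_comm 2, mul_assoc, two_mul]
  gcongr
  linarith

/-! ### Words and excursions along geodesics -/

lemma isLeftInvariantSet_coe_mul {H : Type*} [Group H] (G : Subgroup H) (E : Set H) :
    IsLeftInvariantSet G ((G : Set H) * E) := by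
  have hmul : ∀ γ ∈ G, ∀ g ∈ (G : Set H) * E, γ * g ∈ (G : Set H) * E := by
    rintro γ hγ _ ⟨δ, hδ, h, hh, rfl⟩
    exact ⟨γ * δ, G.mul_mem hγ hδ, h, hh, mul_assoc γ δ h⟩
  refine fun γ hγ g => ⟨fun hg => ?_, hmul γ hγ g⟩
  simpa using hmul γ⁻¹ (G.inv_mem hγ) _ hg

lemma mul_mem_coe_mul_iff {H : Type*} [Group H] {A E : Set H} {b : H}
    (hb : ∀ g, g * b ∈ E ↔ g ∈ E) (g : H) : g * b ∈ A * E ↔ g ∈ A * E := by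
  constructor
  · rintro ⟨δ, hδ, h, hh, heq⟩
    refine ⟨δ, hδ, h * b⁻¹, (hb _).1 (by simpa), ?_⟩
    change δ * (h * b⁻¹) = g
    rw [← mul_assoc, mul_inv_eq_iff_eq_mul]
    exact heq
  · rintro ⟨δ, hδ, h, hh, rfl⟩
    exact ⟨δ, hδ, h * b, (hb h).2 hh, (mul_assoc δ h b).symm⟩

section Words

variable {G : Subgroup SL(2, ℝ)} {S : Set G} {φ : SL(2, ℝ) → ℝ}

/-- The frames `h` such that `log |g'|` at the boundary point `h • ∞` exceeds `ε` times the
word length of `g` by an arbitrarily large amount. -/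
def expandingSet (S : Set G) (ε : ℝ) : Set SL(2, ℝ) :=
  {h | ∀ J : ℕ, ∃ n : ℕ, ∃ g ∈ wordBall S n,
    ε * n + J < Real.log (colSq h 0) - Real.log (colSq (g * h) 0)}

lemma measurableSet_expandingSet [Countable G] (S : Set G) (ε : ℝ) :
    MeasurableSet (expandingSet S ε) := by
  have heq : expandingSet S ε = ⋂ J : ℕ, ⋃ n : ℕ, ⋃ g ∈ wordBall S n,
      {h | ε * n + J < Real.log (colSq h 0) - Real.log (colSq (g * h) 0)} := by
    ext h
    simp [expandingSet]
  rw [heq]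
  refine MeasurableSet.iInter fun J => MeasurableSet.iUnion fun n =>
    MeasurableSet.biUnion (to_countable _) fun g _ => ?_
  have hcol := (continuous_colSq 0).measurable
  exact measurableSet_lt measurable_const
    (hcol.log.sub (hcol.comp (measurable_const_mul (g : SL(2, ℝ)))).log)

lemma mul_mem_expandingSet_iff {b : SL(2, ℝ)} (hb : b 1 0 = 0) (ε : ℝ) (h : SL(2, ℝ)) :
    h * b ∈ expandingSet S ε ↔ h ∈ expandingSet S ε := by
  have hb0 : b 0 0 ≠ 0 := by
    intro h0
    simpa [h0, hb] using det_entries b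
  have hcol : ∀ h : SL(2, ℝ),
      Real.log (colSq (h * b) 0) = Real.log (b 0 0 ^ 2) + Real.log (colSq h 0) := by
    intro h
    rw [← Real.log_mul (pow_ne_zero 2 hb0) (colSq_pos h 0).ne']
    simp only [colSq, mul_entry, hb]
    ring_nf
  simp only [expandingSet, mem_ofPred_eq, ← mul_assoc, hcol, add_sub_add_left_eq_sub]

/- A geodesic `t ↦ m a_t` with closest time `L` to `i` has height `√(A B) cosh (t - L)`, where
`A`, `B` are the column norms of `m`; the shift of `L` caused by `s` is `O(1 / √(A B))`, so the two
factors compensate and the bound does not depend on `m`. -/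
lemma abs_intervalIntegral_logModulus_le (hφ0 : ∀ g, 0 ≤ φ g) (hφ : ∀ g, φ g ≤ frobSq g)
    (s m : SL(2, ℝ)) :
    |∫ t in logModulus m..logModulus (s * m), φ (m * diagFlow t)| ≤
      2 * frobSq s ^ 2 * Real.exp (frobSq s ^ 2) := by
  set r := √(colSq m 0 * colSq m 1)
  have hr : 1 ≤ r := Real.one_le_sqrt.2 (one_le_colSq_mul_colSq m)
  have hshift := abs_logModulus_mul_sub_le s m
  have hbound : ∀ t ∈ uIoc (logModulus m) (logModulus (s * m)),
      ‖φ (m * diagFlow t)‖ ≤ 2 * r * Real.exp (frobSq s ^ 2) := by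
    intro t ht
    rw [Real.norm_of_nonneg (hφ0 _)]
    refine (hφ _).trans (frobSq_mul_diagFlow_le m ?_)
    exact (abs_sub_left_of_mem_uIcc (uIoc_subset_uIcc ht)).trans
      (hshift.trans (div_le_self (sq_nonneg _) hr))
  calc |∫ t in logModulus m..logModulus (s * m), φ (m * diagFlow t)|
      ≤ 2 * r * Real.exp (frobSq s ^ 2) * |logModulus (s * m) - logModulus m| :=
        intervalIntegral.norm_integral_le_of_norm_le_const hbound
    _ ≤ 2 * r * Real.exp (frobSq s ^ 2) * (frobSq s ^ 2 / r) := by gcongr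
    _ = 2 * frobSq s ^ 2 * Real.exp (frobSq s ^ 2) := by
        have : r ≠ 0 := by positivity
        field_simp

lemma intervalIntegrable_mul_diagFlow (hφm : Measurable φ) {M : ℝ} (hφM : ∀ g, ‖φ g‖ ≤ M)
    (h : SL(2, ℝ)) (a b : ℝ) :
    IntervalIntegrable (fun t => φ (h * diagFlow t)) volume a b := by
  have hm : Measurable fun t => φ (h * diagFlow t) :=
    hφm.comp (continuous_diagFlow.measurable.const_mul h)
  exact (intervalIntegrable_const (c := M)).mono_fun hm.aestronglyMeasurable
    (ae_of_all _ fun t => (hφM _).trans (le_abs_self M))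

lemma intervalIntegral_logModulus_le_mul_length
    (hint : ∀ h a b, IntervalIntegrable (fun t => φ (h * diagFlow t)) volume a b)
    (hφ0 : ∀ g, 0 ≤ φ g) (hφ : ∀ g, φ g ≤ frobSq g) (hφG : ∀ γ ∈ G, ∀ g, φ (γ * g) = φ g) {C : ℝ}
    (hC : ∀ s : G, s ∈ S ∨ s⁻¹ ∈ S → 2 * frobSq s ^ 2 * Real.exp (frobSq s ^ 2) ≤ C)
    (h : SL(2, ℝ)) (l : List G) (hl : ∀ s ∈ l, s ∈ S ∨ s⁻¹ ∈ S) :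
    ∫ t in logModulus h..logModulus ((l.prod : G) * h), φ (h * diagFlow t) ≤ C * l.length := by
  induction l with
  | nil => simp
  | cons s l ih =>
    have hprefix := ih fun s hs => hl s (List.mem_cons_of_mem _ hs)
    have hlast := (le_abs_self _).trans (abs_intervalIntegral_logModulus_le hφ0 hφ s (l.prod * h))
    simp only [mul_assoc, hφG _ l.prod.2] at hlast
    have hs := hC s (hl s List.mem_cons_self)
    rw [List.prod_cons, Subgroup.coe_mul, mul_assoc, List.length_cons, Nat.cast_succ,
      ← intervalIntegral.integral_add_adjacent_intervals (hint h _ (logModulus (l.prod * h)))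
        (hint h _ _)]
    linarith

lemma birkhoffSum_mul_diagFlow
    (hint : ∀ h a b, IntervalIntegrable (fun t => φ (h * diagFlow t)) volume a b)
    (h : SL(2, ℝ)) (n : ℕ) :
    birkhoffSum (· * diagFlow 1) (fun g => ∫ t in (0 : ℝ)..1, φ (g * diagFlow t)) n h =
      ∫ t in (0 : ℝ)..n, φ (h * diagFlow t) := by
  have hiter (k : ℕ) : (· * diagFlow 1)^[k] h = h * diagFlow k := by
    induction k with
    | zero => simp [diagFlow_zero]
    | succ k ih => rw [Function.iterate_succ_apply', ih, mul_assoc, ← diagFlow_add, Nat.cast_succ]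
  induction n with
  | zero => simp
  | succ n ih =>
    rw [birkhoffSum_succ, ih, hiter, Nat.cast_succ,
      ← intervalIntegral.integral_add_adjacent_intervals (hint h 0 n) (hint h n (n + 1))]
    congr 1
    simp_rw [mul_assoc, ← diagFlow_add]
    rw [intervalIntegral.integral_comp_add_left (fun t => φ (h * diagFlow t)), add_zero]

lemma exists_intervalIntegral_one_sub_pos {ψ : ℝ → ℝ}
    (hint : ∀ a b, IntervalIntegrable ψ volume a b) {M : ℝ} (hψ : ∀ t, ‖ψ t‖ ≤ M) {c K L T : ℝ}
    (hc : 0 ≤ c) (hK : 0 ≤ K) (hLT : c * ∫ t in L..T, ψ t ≤ K)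
    (hT : K + c * (M * (|L| + 1)) < T) :
    ∃ n : ℕ, 0 < ∫ t in (0 : ℝ)..n, (1 - c * ψ t) := by
  have hM : 0 ≤ M := (norm_nonneg _).trans (hψ 0)
  have hT0 : 0 ≤ T := le_trans (by positivity) hT.le
  have hbound (a b : ℝ) : ∫ t in a..b, ψ t ≤ M * |b - a| :=
    (le_abs_self _).trans (intervalIntegral.norm_integral_le_of_norm_le_const fun t _ => hψ t)
  have hstart : c * ∫ t in (0 : ℝ)..L, ψ t ≤ c * (M * |L|) := by
    gcongr
    simpa using hbound 0 L
  have hend : c * ∫ t in T..⌈T⌉₊, ψ t ≤ c * M := by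
    gcongr
    refine (hbound _ _).trans (mul_le_of_le_one_right hM ?_)
    rw [abs_of_nonneg (sub_nonneg.2 (Nat.le_ceil T))]
    linarith [Nat.ceil_lt_add_one hT0]
  refine ⟨⌈T⌉₊, ?_⟩
  rw [intervalIntegral.integral_sub (by simp) ((hint _ _).const_mul c),
    intervalIntegral.integral_const_mul, intervalIntegral.integral_const, smul_eq_mul, mul_one,
    ← intervalIntegral.integral_add_adjacent_intervals (hint 0 T) (hint T _),
    ← intervalIntegral.integral_add_adjacent_intervals (hint 0 L) (hint _ T)]
  linarith [Nat.le_ceil T]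

lemma exists_intervalIntegral_pos_of_mem_expandingSet
    (hint : ∀ h a b, IntervalIntegrable (fun t => φ (h * diagFlow t)) volume a b) {M : ℝ}
    (hφM : ∀ g, ‖φ g‖ ≤ M) (hφ0 : ∀ g, 0 ≤ φ g) (hφ : ∀ g, φ g ≤ frobSq g)
    (hφG : ∀ γ ∈ G, ∀ g, φ (γ * g) = φ g) {C : ℝ} (hC0 : 0 < C)
    (hC : ∀ s : G, s ∈ S ∨ s⁻¹ ∈ S → 2 * frobSq s ^ 2 * Real.exp (frobSq s ^ 2) ≤ C)
    {ε : ℝ} (hε : 0 < ε) {h : SL(2, ℝ)} (hh : h ∈ expandingSet S ε) :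
    ∃ n : ℕ, 0 < ∫ t in (0 : ℝ)..n, (1 - ε / C * φ (h * diagFlow t)) := by
  obtain ⟨J, hJ⟩ := exists_nat_gt
    (Real.log (colSq h 0) + ε / C * (M * (|logModulus h| + 1)))
  obtain ⟨n, g, ⟨l, hln, hlS, rfl⟩, hlt⟩ := hh J
  refine exists_intervalIntegral_one_sub_pos (K := ε * n) (L := logModulus h)
    (T := logModulus ((l.prod : G) * h)) (hint h) (fun t => hφM _) (by positivity) (by positivity)
    ?_ (by linarith [neg_log_colSq_le_logModulus ((l.prod : G) * h)])
  calc ε / C * ∫ t in logModulus h..logModulus ((l.prod : G) * h), φ (h * diagFlow t)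
      ≤ ε / C * (C * l.length) := by
        gcongr
        exact intervalIntegral_logModulus_le_mul_length hint hφ0 hφ hφG hC h l hlS
    _ = ε * l.length := by field_simp
    _ ≤ ε * n := by gcongr

end Words

/-! ### Small elements of a discrete group -/

lemma encard_le_of_separated {X : Type*} {T : Set X} {f : X → ℝ} {η : ℝ} (hη : 0 < η)
    (hf : ∀ x ∈ T, |f x| ≤ 1) (hsep : ∀ x ∈ T, ∀ y ∈ T, x ≠ y → η ≤ |f x - f y|) :
    T.encard ≤ (2 * ⌈1 / η⌉₊ + 1 : ℕ) := by
  set K := ⌈1 / η⌉₊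
  have hmaps : MapsTo (fun x => ⌊f x / η⌋) T (Finset.Icc (-(K : ℤ)) K : Set ℤ) := by
    intro x hx
    have hxK : |f x / η| ≤ K := by
      rw [abs_div, abs_of_pos hη]
      exact (div_le_div_of_nonneg_right (hf x hx) hη.le).trans (Nat.le_ceil _)
    rw [Finset.coe_Icc]
    refine ⟨Int.le_floor.2 ?_, ?_⟩
    · push_cast
      exact (abs_le.1 hxK).1
    · exact_mod_cast (Int.floor_le _).trans (abs_le.1 hxK).2
  have hinj : InjOn (fun x => ⌊f x / η⌋) T := by
    intro x hx y hy hxy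
    by_contra hne
    have hlt := Int.abs_sub_lt_one_of_floor_eq_floor hxy
    rw [← sub_div, abs_div, abs_of_pos hη, div_lt_one hη] at hlt
    exact hlt.not_ge (hsep x hx y hy hne)
  calc T.encard = ((fun x => ⌊f x / η⌋) '' T).encard := hinj.encard_image.symm
    _ ≤ (Finset.Icc (-(K : ℤ)) K : Set ℤ).encard := encard_le_encard hmaps.image_subset
    _ = (2 * K + 1 : ℕ) := by
      rw [encard_coe_eq_coe_finsetCard, Int.card_Icc]
      norm_cast
      omega

lemma exists_forall_abs_le_of_proportional {ι : Type*} [Finite ι] {v : ι → ℝ} (hv : v ≠ 0) :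
    ∃ i, ∀ w : ι → ℝ, (∀ j, w j * v i = w i * v j) → ∀ j, |w j| ≤ |w i| := by
  obtain ⟨k, hk⟩ := Function.ne_iff.1 hv
  have : Nonempty ι := ⟨k⟩
  obtain ⟨i, hi⟩ := Finite.exists_max fun j => |v j|
  have hvi : 0 < |v i| := (abs_pos.2 hk).trans_le (hi k)
  refine ⟨i, fun w hw j => le_of_mul_le_mul_right ?_ hvi⟩
  calc |w j| * |v i| = |w i| * |v j| := by rw [← abs_mul, hw j, abs_mul]
    _ ≤ |w i| * |v i| := mul_le_mul_of_nonneg_left (hi j) (abs_nonneg _)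

section SmallElements

open scoped Matrix.Norms.Frobenius

lemma norm_sq_eq_frobSq (m : SL(2, ℝ)) : ‖m.1‖ ^ 2 = frobSq m := by
  rw [Matrix.frobenius_norm_def, ← Real.sqrt_eq_rpow, Real.sq_sqrt (by positivity)]
  simp [frobSq, colSq, Fin.sum_univ_two]
  ring

lemma norm_inv_coe (m : SL(2, ℝ)) : ‖(m⁻¹).1‖ = ‖m.1‖ := by
  rw [← sq_eq_sq₀ (norm_nonneg _) (norm_nonneg _), norm_sq_eq_frobSq, norm_sq_eq_frobSq, frobSq_inv]

lemma abs_entry_le_norm (A : Matrix (Fin 2) (Fin 2) ℝ) (i j : Fin 2) : |A i j| ≤ ‖A‖ := by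
  rw [Matrix.frobenius_norm_def, ← Real.sqrt_eq_rpow]
  refine Real.abs_le_sqrt ?_
  simp only [Fin.sum_univ_two, Real.norm_eq_abs, Real.rpow_ofNat, sq_abs]
  revert i j
  simp only [Fin.forall_fin_two]
  refine ⟨⟨?_, ?_⟩, ?_, ?_⟩ <;>
    linarith [sq_nonneg (A 0 0), sq_nonneg (A 0 1), sq_nonneg (A 1 0), sq_nonneg (A 1 1)]

lemma norm_le_two_mul_of_forall_abs_le {A : Matrix (Fin 2) (Fin 2) ℝ} {Δ : ℝ}
    (hA : ∀ i j, |A i j| ≤ Δ) : ‖A‖ ≤ 2 * Δ := by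
  have hΔ : 0 ≤ Δ := (abs_nonneg _).trans (hA 0 0)
  have hsq (i j) : A i j ^ 2 ≤ Δ ^ 2 := sq_le_sq.2 ((hA i j).trans (le_abs_self Δ))
  rw [Matrix.frobenius_norm_def, ← Real.sqrt_eq_rpow]
  refine Real.sqrt_le_iff.2 ⟨by positivity, ?_⟩
  simp only [Fin.sum_univ_two, Real.norm_eq_abs, Real.rpow_ofNat, sq_abs]
  linarith [hsq 0 0, hsq 0 1, hsq 1 0, hsq 1 1]

/-- The neighbourhood of the identity, of radius `1 / 16` in the Frobenius norm, on which
commutators contract and a discrete subgroup is therefore abelian. -/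
def nearOne : Set SL(2, ℝ) := {m | ‖m.1 - 1‖ ≤ 1 / 16}

lemma nearOne_mem_nhds : nearOne ∈ 𝓝 (1 : SL(2, ℝ)) := by
  have hcont : Continuous fun m : SL(2, ℝ) => ‖m.1 - 1‖ :=
    (continuous_subtype_val.sub continuous_const).norm
  refine mem_of_superset ((isOpen_lt hcont (continuous_const (y := 1 / 16))).mem_nhds ?_)
    fun m (hm : ‖m.1 - 1‖ < 1 / 16) => hm.le
  simp

lemma norm_le_two_of_mem_nearOne {m : SL(2, ℝ)} (hm : m ∈ nearOne) : ‖m.1‖ ≤ 2 := by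
  have hone : ‖(1 : Matrix (Fin 2) (Fin 2) ℝ)‖ ≤ 3 / 2 := by
    rw [Matrix.frobenius_norm_def, ← Real.sqrt_eq_rpow]
    refine Real.sqrt_le_iff.2 ⟨by norm_num, ?_⟩
    simp [Matrix.one_apply]
    norm_num
  have htri := norm_add_le (m.1 - 1) 1
  rw [sub_add_cancel] at htri
  have hm' : ‖m.1 - 1‖ ≤ 1 / 16 := hm
  linarith

lemma exists_pos_forall_le_norm_sub_one (G : Subgroup SL(2, ℝ)) [DiscreteTopology G] :
    ∃ c > 0, ∀ γ ∈ G, γ ≠ 1 → c ≤ ‖γ.1 - 1‖ := by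
  have hemb : Topology.IsEmbedding fun γ : G => (γ : SL(2, ℝ)).1 :=
    Topology.IsEmbedding.subtypeVal.comp Topology.IsEmbedding.subtypeVal
  have hball := (Metric.nhds_basis_ball (x := (1 : Matrix (Fin 2) (Fin 2) ℝ))).comap
    fun γ : G => (γ : SL(2, ℝ)).1
  have hnhds := hemb.nhds_eq_comap 1
  rw [nhds_discrete] at hnhds
  obtain ⟨c, hc, hsub⟩ := hball.mem_iff.1 (hnhds ▸ mem_pure.2 (mem_singleton (1 : G)))
  refine ⟨c, hc, fun γ hγ hne => not_lt.1 fun hlt => hne ?_⟩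
  exact congrArg Subtype.val (hsub (a := ⟨γ, hγ⟩) (mem_ball_iff_norm.2 hlt))

/-- The coordinates of the traceless part of `m`. Commuting with `m` forces these coordinates to be
proportional to those of `m`. -/
def tracelessCoords (m : SL(2, ℝ)) : Fin 3 → ℝ := ![m 0 1, m 1 0, m 0 0 - m 1 1]

lemma abs_entries_le_of_mem_nearOne {m : SL(2, ℝ)} (hm : m ∈ nearOne) :
    |m 0 1| ≤ 1 / 16 ∧ |m 1 0| ≤ 1 / 16 ∧ |m 0 0 - 1| ≤ 1 / 16 ∧ |m 1 1 - 1| ≤ 1 / 16 := by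
  have hentry (i j) : |(m.1 - 1) i j| ≤ 1 / 16 := (abs_entry_le_norm _ i j).trans hm
  exact ⟨by simpa using hentry 0 1, by simpa using hentry 1 0, by simpa using hentry 0 0,
    by simpa using hentry 1 1⟩

lemma abs_tracelessCoords_le {m : SL(2, ℝ)} (hm : m ∈ nearOne) (i : Fin 3) :
    |tracelessCoords m i| ≤ 1 / 8 := by
  obtain ⟨h01, h10, h00, h11⟩ := abs_entries_le_of_mem_nearOne hm
  rw [abs_le] at h00 h11 h01 h10 ⊢
  fin_cases i <;> simp [tracelessCoords] <;> constructor <;> linarith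

lemma tracelessCoords_mul_eq_of_commute {m m₀ : SL(2, ℝ)} (h : Commute m m₀) (i j : Fin 3) :
    tracelessCoords m j * tracelessCoords m₀ i = tracelessCoords m i * tracelessCoords m₀ j := by
  have hentry (k l) : (m * m₀) k l = (m₀ * m) k l := by rw [h.eq]
  have h00 := hentry 0 0
  have h01 := hentry 0 1
  have h10 := hentry 1 0
  simp only [mul_entry] at h00 h01 h10
  fin_cases i <;> fin_cases j <;> simp [tracelessCoords] <;> linarith

lemma eq_one_of_tracelessCoords_eq_zero {m : SL(2, ℝ)} (hm : m ∈ nearOne)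
    (h : tracelessCoords m = 0) : m = 1 := by
  have h01 : m 0 1 = 0 := congrFun h 0
  have h10 : m 1 0 = 0 := congrFun h 1
  have hdiag : m 0 0 - m 1 1 = 0 := congrFun h 2
  have hdet := det_entries m
  obtain ⟨-, -, h00, -⟩ := abs_entries_le_of_mem_nearOne hm
  have hone : m 0 0 = 1 := by
    rw [h01, zero_mul, sub_zero, ← sub_eq_zero.1 hdiag] at hdet
    refine (mul_self_eq_one_iff.1 hdet).resolve_right fun hneg => ?_
    rw [hneg] at h00
    norm_num at h00
  ext i j
  fin_cases i <;> fin_cases j <;> simp [h01, h10, hone, ← sub_eq_zero.1 hdiag]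

/- Since `(tr m) ^ 2 = 4 + (m₀₀ - m₁₁) ^ 2 + 4 m₀₁ m₁₀`, the traceless part determines the trace of
an element near the identity. -/
lemma abs_trace_sub_le {m m' : SL(2, ℝ)} (hm : m ∈ nearOne) (hm' : m' ∈ nearOne) {Δ : ℝ}
    (hΔ : ∀ i, |tracelessCoords m i - tracelessCoords m' i| ≤ Δ) :
    |(m 0 0 + m 1 1) - (m' 0 0 + m' 1 1)| ≤ Δ := by
  obtain ⟨-, h10, h00, h11⟩ := abs_entries_le_of_mem_nearOne hm
  obtain ⟨h01', -, h00', h11'⟩ := abs_entries_le_of_mem_nearOne hm'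
  have hb : |m 0 1 - m' 0 1| ≤ Δ := hΔ 0
  have hc : |m 1 0 - m' 1 0| ≤ Δ := hΔ 1
  have hd : |m 0 0 - m 1 1 - (m' 0 0 - m' 1 1)| ≤ Δ := hΔ 2
  have hΔ0 : 0 ≤ Δ := (abs_nonneg _).trans hb
  have hfactor : ((m 0 0 + m 1 1) - (m' 0 0 + m' 1 1)) * ((m 0 0 + m 1 1) + (m' 0 0 + m' 1 1)) =
      (m 0 0 - m 1 1 - (m' 0 0 - m' 1 1)) * ((m 0 0 - m 1 1) + (m' 0 0 - m' 1 1)) +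
        4 * ((m 0 1 - m' 0 1) * m 1 0) + 4 * (m' 0 1 * (m 1 0 - m' 1 0)) := by
    linear_combination 4 * det_entries m - 4 * det_entries m'
  have htr : 3 ≤ |(m 0 0 + m 1 1) + (m' 0 0 + m' 1 1)| := by
    rw [abs_le] at h00 h11 h00' h11'
    exact le_trans (by linarith) (le_abs_self _)
  have hdiff : |(m 0 0 - m 1 1) + (m' 0 0 - m' 1 1)| ≤ 1 / 4 := by
    rw [abs_le] at h00 h11 h00' h11' ⊢
    constructor <;> linarith
  have hprod : |(m 0 0 + m 1 1) - (m' 0 0 + m' 1 1)| * 3 ≤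
      Δ * (1 / 4) + 4 * (Δ * (1 / 16)) + 4 * (1 / 16 * Δ) := by
    refine (mul_le_mul_of_nonneg_left htr (abs_nonneg _)).trans ?_
    rw [← abs_mul, hfactor]
    refine (abs_add_three _ _ _).trans ?_
    simp only [abs_mul, Nat.abs_ofNat]
    gcongr
  linarith

lemma norm_sub_le_of_tracelessCoords {m m' : SL(2, ℝ)} (hm : m ∈ nearOne) (hm' : m' ∈ nearOne)
    {Δ : ℝ} (hΔ : ∀ i, |tracelessCoords m i - tracelessCoords m' i| ≤ Δ) :
    ‖m.1 - m'.1‖ ≤ 2 * Δ := by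
  have htr := abs_le.1 (abs_trace_sub_le hm hm' hΔ)
  have hb : |m 0 1 - m' 0 1| ≤ Δ := hΔ 0
  have hc : |m 1 0 - m' 1 0| ≤ Δ := hΔ 1
  have hd : |m 0 0 - m 1 1 - (m' 0 0 - m' 1 1)| ≤ Δ := hΔ 2
  rw [abs_le] at hd
  refine norm_le_two_mul_of_forall_abs_le fun i j => ?_
  rw [Matrix.sub_apply]
  fin_cases i <;> fin_cases j
  · exact abs_le.2 ⟨by dsimp; linarith, by dsimp; linarith⟩
  · exact hb
  · exact hc
  · exact abs_le.2 ⟨by dsimp; linarith, by dsimp; linarith⟩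

lemma norm_commutator_sub_one_le_half {m m₀ : SL(2, ℝ)} (hm : m ∈ nearOne) (hm₀ : m₀ ∈ nearOne) :
    ‖(m * m₀ * m⁻¹ * m₀⁻¹).1 - 1‖ ≤ ‖m₀.1 - 1‖ / 2 := by
  have h16 : ‖m.1 - 1‖ ≤ 1 / 16 := hm
  calc ‖(m * m₀ * m⁻¹ * m₀⁻¹).1 - 1‖
      ≤ 2 * ‖(m⁻¹).1‖ * ‖(m₀⁻¹).1‖ * ‖m.1 - 1‖ * ‖m₀.1 - 1‖ :=
        norm_commutator_units_sub_one_le (m : GL (Fin 2) ℝ) (m₀ : GL (Fin 2) ℝ)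
    _ ≤ 2 * 2 * 2 * (1 / 16) * ‖m₀.1 - 1‖ := by
        rw [norm_inv_coe, norm_inv_coe]
        gcongr
        exacts [norm_le_two_of_mem_nearOne hm, norm_le_two_of_mem_nearOne hm₀]
    _ = ‖m₀.1 - 1‖ / 2 := by ring

section Separated

variable {Γ : Subgroup SL(2, ℝ)} {η : ℝ}

/- An element almost minimizing the distance to `1` works: its commutators are closer to `1`. -/
lemma exists_commute_of_separated (hη : 0 < η) (hΓ : ∀ γ ∈ Γ, γ ≠ 1 → η ≤ ‖γ.1 - 1‖)
    (hne : ∃ m ∈ Γ, m ∈ nearOne ∧ m ≠ 1) :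
    ∃ m₀ ∈ nearOne, m₀ ≠ 1 ∧ ∀ m ∈ Γ, m ∈ nearOne → Commute m m₀ := by
  set D := (fun m : SL(2, ℝ) => ‖m.1 - 1‖) '' {m | m ∈ Γ ∧ m ∈ nearOne ∧ m ≠ 1}
  have hbdd : BddBelow D := ⟨0, by rintro _ ⟨m, -, rfl⟩; exact norm_nonneg _⟩
  have hDne : D.Nonempty := Set.Nonempty.image _ hne
  have hinf : 0 < sInf D :=
    hη.trans_le (le_csInf hDne (by rintro _ ⟨m, ⟨hm, -, hm1⟩, rfl⟩; exact hΓ m hm hm1))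
  obtain ⟨_, ⟨m₀, ⟨hm₀, hm₀n, hm₀1⟩, rfl⟩, hlt⟩ :=
    exists_lt_of_csInf_lt hDne (show sInf D < 2 * sInf D by linarith)
  refine ⟨m₀, hm₀n, hm₀1, fun m hm hmn => ?_⟩
  have hle := norm_commutator_sub_one_le_half hmn hm₀n
  by_contra hcomm
  have hmem : ‖(m * m₀ * m⁻¹ * m₀⁻¹).1 - 1‖ ∈ D := by
    refine ⟨_, ⟨?_, ?_, fun h1 => hcomm ?_⟩, rfl⟩
    · exact Γ.mul_mem (Γ.mul_mem (Γ.mul_mem hm hm₀) (Γ.inv_mem hm)) (Γ.inv_mem hm₀)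
    · have : ‖m₀.1 - 1‖ ≤ 1 / 16 := hm₀n
      exact hle.trans (by linarith)
    · rwa [mul_inv_eq_one, mul_inv_eq_iff_eq_mul] at h1
  linarith [csInf_le hbdd hmem]

lemma encard_inter_nearOne_le (hη : 0 < η) (hΓ : ∀ γ ∈ Γ, γ ≠ 1 → η ≤ ‖γ.1 - 1‖) :
    ((Γ : Set SL(2, ℝ)) ∩ nearOne).encard ≤ (2 * ⌈4 / η⌉₊ + 1 : ℕ) := by
  by_cases hne : ∃ m ∈ Γ, m ∈ nearOne ∧ m ≠ 1
  swap
  · push Not at hne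
    refine (encard_le_encard (t := {1}) fun m hm => hne m hm.1 hm.2).trans ?_
    rw [encard_singleton]
    exact_mod_cast Nat.le_add_left 1 _
  obtain ⟨m₀, hm₀, hm₀1, hcomm⟩ := exists_commute_of_separated hη hΓ hne
  obtain ⟨i, hi⟩ := exists_forall_abs_le_of_proportional
    fun h => hm₀1 (eq_one_of_tracelessCoords_eq_zero hm₀ h)
  rw [← one_div_div]
  refine encard_le_of_separated (f := fun m => tracelessCoords m i) (by positivity)
    (fun m hm => (abs_tracelessCoords_le hm.2 i).trans (by norm_num)) fun m hm m' hm' hmm' => ?_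
  have hcoord : ‖m.1 - m'.1‖ ≤ 2 * |tracelessCoords m i - tracelessCoords m' i| := by
    refine norm_sub_le_of_tracelessCoords hm.2 hm'.2 <|
      hi (fun j => tracelessCoords m j - tracelessCoords m' j) fun j => ?_
    linear_combination tracelessCoords_mul_eq_of_commute (hcomm m hm.1 hm.2) i j -
      tracelessCoords_mul_eq_of_commute (hcomm m' hm'.1 hm'.2) i j
  have hdist : η ≤ ‖(m * m'⁻¹).1 - 1‖ :=
    hΓ _ (Γ.mul_mem hm.1 (Γ.inv_mem hm'.1)) (by simpa [mul_inv_eq_one] using hmm')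
  have hfactor : (m * m'⁻¹).1 - 1 = (m.1 - m'.1) * (m'⁻¹).1 := by
    rw [sub_mul, ← Matrix.SpecialLinearGroup.coe_mul, ← Matrix.SpecialLinearGroup.coe_mul,
      mul_inv_cancel, Matrix.SpecialLinearGroup.coe_one]
  have hle : ‖(m * m'⁻¹).1 - 1‖ ≤ ‖m.1 - m'.1‖ * 2 := by
    rw [hfactor]
    refine (norm_mul_le _ _).trans ?_
    rw [norm_inv_coe]
    gcongr
    exact norm_le_two_of_mem_nearOne hm'.2
  linarith

end Separated

lemma norm_conj_sub_one_le (h m : SL(2, ℝ)) :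
    ‖(h * m * h⁻¹).1 - 1‖ ≤ frobSq h * ‖m.1 - 1‖ := by
  have hconj : (h * m * h⁻¹).1 - 1 = h.1 * (m.1 - 1) * (h⁻¹).1 := by
    have hinv : h.1 * (h⁻¹).1 = 1 := by
      rw [← Matrix.SpecialLinearGroup.coe_mul, mul_inv_cancel, Matrix.SpecialLinearGroup.coe_one]
    rw [Matrix.SpecialLinearGroup.coe_mul, Matrix.SpecialLinearGroup.coe_mul, mul_sub, sub_mul,
      mul_one, hinv]
  rw [hconj]
  refine norm_mul₃_le.trans_eq ?_
  rw [norm_inv_coe, ← norm_sq_eq_frobSq]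
  ring

lemma exists_encard_conj_inter_nearOne_le (G : Subgroup SL(2, ℝ)) [DiscreteTopology G] :
    ∃ c > 0, ∀ h : SL(2, ℝ),
      {m | h * m * h⁻¹ ∈ G ∧ m ∈ nearOne}.encard ≤ (2 * ⌈c * frobSq h⌉₊ + 1 : ℕ) := by
  obtain ⟨c, hc0, hc⟩ := exists_pos_forall_le_norm_sub_one G
  refine ⟨4 / c, by positivity, fun h => ?_⟩
  have hfrob : 0 < frobSq h := two_pos.trans_le (two_le_frobSq h)
  have hsep : ∀ m ∈ G.comap (MulAut.conj h).toMonoidHom, m ≠ 1 → c / frobSq h ≤ ‖m.1 - 1‖ := by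
    intro m hm hm1
    rw [div_le_iff₀' hfrob]
    exact (hc _ hm (by simpa [mul_inv_eq_one] using hm1)).trans (norm_conj_sub_one_le h m)
  have hcard := encard_inter_nearOne_le (div_pos hc0 hfrob) hsep
  rwa [div_div_eq_mul_div, mul_div_right_comm] at hcard

end SmallElements

/-! ### Depth in the cusps -/

lemma coe_smul_I (g : SL(2, ℝ)) :
    ((g • UpperHalfPlane.I : ℍ) : ℂ) =
      ⟨(g 0 0 * g 1 0 + g 0 1 * g 1 1) / (g 1 0 ^ 2 + g 1 1 ^ 2),
        1 / (g 1 0 ^ 2 + g 1 1 ^ 2)⟩ := by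
  have hdet := det_entries g
  have hbottom : (g 1 0 : ℂ) * Complex.I + g 1 1 ≠ 0 := by
    simpa [UpperHalfPlane.denom] using
      UpperHalfPlane.denom_ne_zero (g : GL (Fin 2) ℝ) UpperHalfPlane.I
  have hpos : g 1 0 ^ 2 + g 1 1 ^ 2 ≠ 0 := by
    have := (Complex.normSq_pos.2 hbottom).ne'
    simpa [Complex.normSq_apply, sq, add_comm] using this
  rw [UpperHalfPlane.coe_specialLinearGroup_apply]
  refine (div_eq_iff hbottom).2 (Complex.ext ?_ ?_) <;> simp <;> field_simp
  · linear_combination (-(g 1 0)) * hdet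
  · linear_combination (g 1 1) * hdet

lemma frobSq_eq_two_mul_cosh_dist (g : SL(2, ℝ)) :
    frobSq g = 2 * Real.cosh (dist (g • UpperHalfPlane.I) UpperHalfPlane.I) := by
  have him : (g • UpperHalfPlane.I : ℍ).im = 1 / (g 1 0 ^ 2 + g 1 1 ^ 2) := by
    rw [← UpperHalfPlane.coe_im, coe_smul_I]
  have hpos : 0 < g 1 0 ^ 2 + g 1 1 ^ 2 := one_div_pos.1 (him ▸ (g • UpperHalfPlane.I).im_pos)
  rw [UpperHalfPlane.cosh_dist, Complex.dist_eq, ← Complex.normSq_eq_norm_sq, coe_smul_I, him,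
    Complex.normSq_apply]
  simp only [frobSq, colSq, UpperHalfPlane.coe_I, Complex.sub_re, Complex.sub_im, Complex.I_re,
    Complex.I_im, UpperHalfPlane.I_im]
  field_simp
  linear_combination (g 0 0 * g 1 1 - g 0 1 * g 1 0 + 1) * det_entries g

lemma frobSq_le_two_mul_exp_dist (g : SL(2, ℝ)) :
    frobSq g ≤ 2 * Real.exp (dist (g • UpperHalfPlane.I) UpperHalfPlane.I) := by
  rw [frobSq_eq_two_mul_cosh_dist, ← Real.cosh_add_sinh]
  linarith [Real.sinh_lt_cosh (dist (g • UpperHalfPlane.I) UpperHalfPlane.I),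
    Real.sinh_nonneg_iff.2 (dist_nonneg (x := g • UpperHalfPlane.I) (y := UpperHalfPlane.I))]

lemma exp_dist_le_frobSq (g : SL(2, ℝ)) :
    Real.exp (dist (g • UpperHalfPlane.I) UpperHalfPlane.I) ≤ frobSq g := by
  rw [frobSq_eq_two_mul_cosh_dist, ← Real.cosh_add_sinh]
  linarith [Real.sinh_lt_cosh (dist (g • UpperHalfPlane.I) UpperHalfPlane.I)]

/-- The distance from `g • i` to the orbit `G • i`. As a function on `G \ SL(2, ℝ)` it measures how
deep `g` lies in the cusps. -/
noncomputable def orbitDist (G : Subgroup SL(2, ℝ)) (g : SL(2, ℝ)) : ℝ :=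
  Metric.infDist (g • UpperHalfPlane.I) (MulAction.orbit G UpperHalfPlane.I)

section OrbitDist

variable {G : Subgroup SL(2, ℝ)}

lemma orbitDist_mul {γ : SL(2, ℝ)} (hγ : γ ∈ G) (g : SL(2, ℝ)) :
    orbitDist G (γ * g) = orbitDist G g := by
  have horbit :
      (γ • ·) '' MulAction.orbit G UpperHalfPlane.I = MulAction.orbit G UpperHalfPlane.I :=
    MulAction.smul_orbit (⟨γ, hγ⟩ : G) UpperHalfPlane.I
  rw [orbitDist, mul_smul]
  nth_rw 1 [← horbit]
  exact Metric.infDist_image (isometry_smul ℍ γ)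

lemma continuous_orbitDist : Continuous (orbitDist G) := by
  have hsmul : Continuous fun g : SL(2, ℝ) => g • UpperHalfPlane.I := by fun_prop
  exact (Metric.continuous_infDist_pt _).comp hsmul

lemma orbitDist_le_dist (g : SL(2, ℝ)) :
    orbitDist G g ≤ dist (g • UpperHalfPlane.I) UpperHalfPlane.I :=
  Metric.infDist_le_dist_of_mem (MulAction.mem_orbit_self _)

lemma abs_orbitDist_sub_le (g h : SL(2, ℝ)) :
    |orbitDist G g - orbitDist G h| ≤ dist (g • UpperHalfPlane.I) (h • UpperHalfPlane.I) := by
  simpa [Real.dist_eq, orbitDist] using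
    (Metric.lipschitz_infDist_pt (MulAction.orbit G UpperHalfPlane.I)).dist_le_mul
      (g • UpperHalfPlane.I) (h • UpperHalfPlane.I)

lemma exp_orbitDist_le_frobSq (g : SL(2, ℝ)) : Real.exp (orbitDist G g) ≤ frobSq g :=
  (Real.exp_le_exp.2 (orbitDist_le_dist g)).trans (exp_dist_le_frobSq g)

lemma exists_mem_dist_mul_smul_I_lt {g : SL(2, ℝ)} {r : ℝ} (hr : orbitDist G g < r) :
    ∃ γ ∈ G, dist ((γ * g) • UpperHalfPlane.I) UpperHalfPlane.I < r := by
  obtain ⟨_, ⟨γ, rfl⟩, hγ⟩ := (Metric.infDist_lt_iff ⟨_, MulAction.mem_orbit_self _⟩).1 hr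
  refine ⟨(γ : SL(2, ℝ))⁻¹, G.inv_mem γ.2, ?_⟩
  rw [← dist_smul (γ : SL(2, ℝ)), smul_smul, mul_inv_cancel_left]
  exact hγ

lemma exists_le_orbitDist (hnc : ¬ CompactSpace (MulAction.orbitRel.Quotient G ℍ)) (r : ℝ) :
    ∃ g, r ≤ orbitDist G g := by
  by_contra! hcon
  have hcover : (Quotient.mk'' : ℍ → MulAction.orbitRel.Quotient G ℍ) ''
      Metric.closedBall UpperHalfPlane.I r = univ := by
    refine eq_univ_of_forall fun q => ?_
    obtain ⟨z, rfl⟩ := Quotient.exists_rep q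
    obtain ⟨g, rfl⟩ := MulAction.exists_smul_eq SL(2, ℝ) UpperHalfPlane.I z
    obtain ⟨γ, hγ, hdist⟩ := exists_mem_dist_mul_smul_I_lt (hcon g)
    exact ⟨(γ * g) • UpperHalfPlane.I, hdist.le,
      Quotient.sound' ⟨⟨γ, hγ⟩, (mul_smul γ g UpperHalfPlane.I).symm⟩⟩
  exact hnc ⟨hcover ▸ (isCompact_closedBall _ _).image continuous_quotient_mk'⟩

lemma exists_orbitDist_eq_frobSq_le (hnc : ¬ CompactSpace (MulAction.orbitRel.Quotient G ℍ))
    {r : ℝ} (hr : 0 ≤ r) : ∃ h, orbitDist G h = r ∧ frobSq h ≤ 2 * Real.exp (r + 1) := by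
  have hone : orbitDist G 1 = 0 := by
    rw [orbitDist, one_smul]
    exact Metric.infDist_zero_of_mem (MulAction.mem_orbit_self _)
  obtain ⟨z, hz⟩ : ∃ z, Metric.infDist z (MulAction.orbit G UpperHalfPlane.I) = r := by
    obtain ⟨g, hg⟩ := exists_le_orbitDist hnc r
    exact mem_range_of_exists_le_of_exists_ge (Metric.continuous_infDist_pt _)
      ⟨(1 : SL(2, ℝ)) • UpperHalfPlane.I, hone.trans_le hr⟩ ⟨_, hg⟩
  obtain ⟨g, rfl⟩ := MulAction.exists_smul_eq SL(2, ℝ) UpperHalfPlane.I z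
  obtain ⟨γ, hγ, hdist⟩ := exists_mem_dist_mul_smul_I_lt (hz.trans_lt (lt_add_one r))
  refine ⟨γ * g, (orbitDist_mul hγ g).trans hz, (frobSq_le_two_mul_exp_dist _).trans ?_⟩
  gcongr

end OrbitDist

/-! ### The cusps carry infinite weight -/

section CuspWeight

variable {G : Subgroup SL(2, ℝ)} {μ : Measure SL(2, ℝ)} {V : Set SL(2, ℝ)}

lemma exists_isOpen_dist_lt_one_mul_inv_mem_nearOne :
    ∃ V : Set SL(2, ℝ), IsOpen V ∧ 1 ∈ V ∧
      (∀ v ∈ V, dist (v • UpperHalfPlane.I) UpperHalfPlane.I < 1) ∧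
      ∀ v ∈ V, ∀ w ∈ V, v * w⁻¹ ∈ nearOne := by
  have hsmul : Continuous fun g : SL(2, ℝ) => g • UpperHalfPlane.I := by fun_prop
  obtain ⟨W, hW, hWs⟩ := exists_nhds_split_inv nearOne_mem_nhds
  refine ⟨interior W ∩ (· • UpperHalfPlane.I) ⁻¹' Metric.ball UpperHalfPlane.I 1,
    isOpen_interior.inter (Metric.isOpen_ball.preimage hsmul),
    ⟨mem_interior_iff_mem_nhds.2 hW, by simp⟩, fun v hv => hv.2, fun v hv w hw => ?_⟩
  rw [← div_eq_mul_inv]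
  exact hWs v (interior_subset hv.1) w (interior_subset hw.1)

lemma haarSL_ne_top_of_dist_lt_one
    (hV : ∀ v ∈ V, dist (v • UpperHalfPlane.I) UpperHalfPlane.I < 1) : haarSL V ≠ ⊤ := by
  have hcompact := UpperHalfPlane.isProperMap_smul_I.isCompact_preimage
    (isCompact_closedBall UpperHalfPlane.I 1)
  exact measure_ne_top_of_subset (fun v hv => (hV v hv).le) hcompact.measure_ne_top

lemma encard_setOf_mul_mem_smul_le {H : Type*} [Group H] (G : Subgroup H) {V U : Set H}
    (hVU : ∀ v ∈ V, ∀ w ∈ V, v * w⁻¹ ∈ U) (h g : H) :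
    {γ | γ ∈ G ∧ γ * g ∈ h • V}.encard ≤ {m | h * m * h⁻¹ ∈ G ∧ m ∈ U}.encard := by
  rcases eq_empty_or_nonempty {γ | γ ∈ G ∧ γ * g ∈ h • V} with hempty | ⟨γ₀, hγ₀, hγ₀V⟩
  · simp [hempty]
  refine encard_le_encard_of_injOn (f := fun γ => h⁻¹ * (γ * γ₀⁻¹) * h) ?_ ?_
  · rintro γ ⟨hγ, hγV⟩
    rw [mem_smul_set_iff_inv_smul_mem, smul_eq_mul] at hγV hγ₀V
    refine ⟨by simpa [mul_assoc] using G.mul_mem hγ (G.inv_mem hγ₀), ?_⟩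
    convert hVU _ hγV _ hγ₀V using 1
    group
  · intro γ _ γ' _ hγγ'
    simpa using hγγ'

lemma IsCovolumeMeasure.exists_pos_le_frobSq_mul_measureReal [DiscreteTopology G]
    (hμ : IsCovolumeMeasure haarSL G μ) (hVo : IsOpen V) (hV1 : 1 ∈ V)
    (hV : ∀ v ∈ V, dist (v • UpperHalfPlane.I) UpperHalfPlane.I < 1)
    (hVV : ∀ v ∈ V, ∀ w ∈ V, v * w⁻¹ ∈ nearOne) :
    ∃ a > 0, ∀ h, a ≤ frobSq h * μ.real (G * h • V) := by
  have : IsFiniteMeasure μ := ⟨hμ.lt_top⟩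
  obtain ⟨c, hc0, hc⟩ := exists_encard_conj_inter_nearOne_le G
  have hvpos : 0 < haarSL.real V :=
    ENNReal.toReal_pos (hVo.measure_pos haarSL ⟨1, hV1⟩).ne' (haarSL_ne_top_of_dist_lt_one hV)
  refine ⟨haarSL.real V / (2 * c + 3), by positivity, fun h => ?_⟩
  have hle : haarSL (h • V) ≤ (2 * ⌈c * frobSq h⌉₊ + 1 : ℕ) * μ (G * h • V) :=
    hμ.le_mul _ _ _ (hVo.smul h).measurableSet (hVo.smul h).mul_left.measurableSet
      (isLeftInvariantSet_coe_mul G _) (subset_mul_right _ G.one_mem) fun g =>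
      (encard_setOf_mul_mem_smul_le G hVV h g).trans (hc h)
  have hreal : haarSL.real V ≤ (2 * ⌈c * frobSq h⌉₊ + 1 : ℕ) * μ.real (G * h • V) := by
    rw [measure_smul] at hle
    refine (ENNReal.toReal_mono
      (ENNReal.mul_ne_top (ENNReal.natCast_ne_top _) (measure_ne_top μ _)) hle).trans_eq ?_
    rw [ENNReal.toReal_mul, ENNReal.toReal_natCast, measureReal_def]
  have hfrob := two_le_frobSq h
  have hceil : ((2 * ⌈c * frobSq h⌉₊ + 1 : ℕ) : ℝ) ≤ (2 * c + 3) * frobSq h := by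
    have := Nat.ceil_lt_add_one (a := c * frobSq h) (by positivity)
    push_cast
    linarith
  rw [div_le_iff₀' (by positivity), ← mul_assoc]
  exact hreal.trans (mul_le_mul_of_nonneg_right hceil measureReal_nonneg)

lemma abs_orbitDist_sub_lt_one (hV : ∀ v ∈ V, dist (v • UpperHalfPlane.I) UpperHalfPlane.I < 1)
    {h g : SL(2, ℝ)} (hg : g ∈ (G : Set SL(2, ℝ)) * h • V) :
    |orbitDist G g - orbitDist G h| < 1 := by
  obtain ⟨γ, hγ, _, ⟨v, hv, rfl⟩, rfl⟩ := hg
  rw [orbitDist_mul hγ]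
  refine (abs_orbitDist_sub_le _ _).trans_lt ?_
  simp_rw [smul_eq_mul, mul_smul, dist_smul]
  exact hV v hv

lemma sum_indicator_exp_le_min_exp {X : Type*} {d : X → ℝ} {E : ℕ → Set X}
    (hE : ∀ k, ∀ x ∈ E k, |d x - 3 * k| < 1) (n : ℕ) (x : X) :
    ∑ k ∈ Finset.range n, (E k).indicator (fun _ => Real.exp (3 * k - 1)) x ≤
      min (Real.exp (d x)) (Real.exp (3 * n)) := by
  by_cases hx : ∃ k ∈ Finset.range n, x ∈ E k
  swap
  · push Not at hx
    rw [Finset.sum_eq_zero fun k hk => indicator_of_notMem (hx k hk) _]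
    positivity
  obtain ⟨k, hk, hxk⟩ := hx
  have hdk := abs_lt.1 (hE k x hxk)
  have hkn : (k : ℝ) ≤ n := mod_cast (Finset.mem_range.1 hk).le
  rw [Finset.sum_eq_single_of_mem k hk, indicator_of_mem hxk]
  · exact le_min (Real.exp_le_exp.2 (by linarith)) (Real.exp_le_exp.2 (by linarith))
  · intro j _ hjk
    refine indicator_of_notMem (fun hxj => hjk ?_) _
    have hdj := abs_lt.1 (hE j x hxj)
    have hlt : (j : ℝ) < k + 1 := by linarith
    have hgt : (k : ℝ) < j + 1 := by linarith
    norm_cast at hlt hgt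
    omega

lemma IsCovolumeMeasure.integrable_min_exp_orbitDist (hμ : IsCovolumeMeasure haarSL G μ) (M : ℝ) :
    Integrable (fun g => min (Real.exp (orbitDist G g)) (Real.exp M)) μ := by
  have : IsFiniteMeasure μ := ⟨hμ.lt_top⟩
  refine Integrable.of_bound ((Real.continuous_exp.comp continuous_orbitDist).min
    continuous_const).measurable.aestronglyMeasurable (Real.exp M) (ae_of_all _ fun g => ?_)
  rw [Real.norm_of_nonneg (by positivity)]
  exact min_le_right _ _

/- The shell of depth about `3 k` has measure at least a multiple of `exp (-3 k)`, as an element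
`h` of that depth can be chosen with `frobSq h` of order `exp (3 k)`: all shells carry comparable
weight. -/
lemma IsCovolumeMeasure.exists_lt_integral_min_exp_orbitDist [DiscreteTopology G]
    (hμ : IsCovolumeMeasure haarSL G μ) (hnc : ¬ CompactSpace (MulAction.orbitRel.Quotient G ℍ))
    (K : ℝ) : ∃ M, K < ∫ g, min (Real.exp (orbitDist G g)) (Real.exp M) ∂μ := by
  have : IsFiniteMeasure μ := ⟨hμ.lt_top⟩
  obtain ⟨V, hVo, hV1, hV, hVV⟩ := exists_isOpen_dist_lt_one_mul_inv_mem_nearOne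
  obtain ⟨a, ha, hmass⟩ := hμ.exists_pos_le_frobSq_mul_measureReal hVo hV1 hV hVV
  choose h hh hfrob using fun k : ℕ =>
    exists_orbitDist_eq_frobSq_le hnc (r := 3 * k) (by positivity)
  set E : ℕ → Set SL(2, ℝ) := fun k => G * h k • V
  have hE (k) : MeasurableSet (E k) := (hVo.smul (h k)).mul_left.measurableSet
  have hdist : ∀ k, ∀ g ∈ E k, |orbitDist G g - 3 * k| < 1 :=
    fun k g hg => hh k ▸ abs_orbitDist_sub_lt_one hV hg
  have hshell (k : ℕ) : a / (2 * Real.exp 2) ≤ Real.exp (3 * k - 1) * μ.real (E k) := by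
    rw [div_le_iff₀' (by positivity), ← mul_assoc, mul_assoc 2, ← Real.exp_add]
    refine (hmass (h k)).trans (mul_le_mul_of_nonneg_right ?_ measureReal_nonneg)
    exact (hfrob k).trans_eq (by ring_nf)
  have hindicator (k : ℕ) : Integrable ((E k).indicator fun _ => Real.exp (3 * k - 1)) μ :=
    (integrable_const _).indicator (hE k)
  obtain ⟨n, hn⟩ := exists_nat_gt (K / (a / (2 * Real.exp 2)))
  refine ⟨3 * n, ?_⟩
  calc K < ∑ k ∈ Finset.range n, a / (2 * Real.exp 2) := by
        rw [div_lt_iff₀ (by positivity)] at hn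
        simpa using hn
    _ ≤ ∑ k ∈ Finset.range n, Real.exp (3 * k - 1) * μ.real (E k) :=
        Finset.sum_le_sum fun k _ => hshell k
    _ = ∫ g, ∑ k ∈ Finset.range n, (E k).indicator (fun _ => Real.exp (3 * k - 1)) g ∂μ := by
        rw [integral_finsetSum _ fun k _ => hindicator k]
        refine Finset.sum_congr rfl fun k _ => ?_
        rw [integral_indicator_const _ (hE k), smul_eq_mul, mul_comm]
    _ ≤ ∫ g, min (Real.exp (orbitDist G g)) (Real.exp (3 * n)) ∂μ :=
        integral_mono (integrable_finsetSum _ fun k _ => hindicator k)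
          (hμ.integrable_min_exp_orbitDist _) (sum_indicator_exp_le_min_exp hdist n)

end CuspWeight

/-! ### The expanding set is null -/

lemma measurableSet_coe_mul {H : Type*} [Group H] [MeasurableSpace H] [MeasurableMul H]
    (G : Subgroup H) [Countable G] {E : Set H} (hE : MeasurableSet E) :
    MeasurableSet ((G : Set H) * E) := by
  rw [← smul_eq_mul, ← iUnion_smul_set]
  exact MeasurableSet.biUnion (to_countable _) fun γ _ => hE.const_smul γ

section MaximalFlow

variable {G : Subgroup SL(2, ℝ)} {μ : Measure SL(2, ℝ)} {ψ : SL(2, ℝ) → ℝ} {M : ℝ}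

lemma IsCovolumeMeasure.integral_intervalIntegral_mul_diagFlow (hμ : IsCovolumeMeasure haarSL G μ)
    (hψm : Measurable ψ) (hψG : ∀ γ ∈ G, ∀ g, ψ (γ * g) = ψ g) (hψM : ∀ g, ‖ψ g‖ ≤ M) :
    ∫ g, (∫ t in (0 : ℝ)..1, ψ (g * diagFlow t)) ∂μ = ∫ g, ψ g ∂μ := by
  have : IsFiniteMeasure μ := ⟨hμ.lt_top⟩
  have hm : Measurable fun p : SL(2, ℝ) × ℝ => ψ (p.1 * diagFlow p.2) :=
    hψm.comp (measurable_fst.mul (continuous_diagFlow.measurable.comp measurable_snd))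
  simp_rw [intervalIntegral.integral_of_le zero_le_one]
  rw [integral_integral_swap
    (Integrable.of_bound hm.aestronglyMeasurable M (ae_of_all _ fun _ => hψM _))]
  simp_rw [hμ.integral_comp_mul_right hψm hψG]
  simp

lemma measurable_intervalIntegral_mul_diagFlow (hψm : Measurable ψ) :
    Measurable fun g => ∫ t in (0 : ℝ)..1, ψ (g * diagFlow t) := by
  have hm : Measurable fun p : SL(2, ℝ) × ℝ => ψ (p.1 * diagFlow p.2) :=
    hψm.comp (measurable_fst.mul (continuous_diagFlow.measurable.comp measurable_snd))
  simp_rw [intervalIntegral.integral_of_le zero_le_one]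
  exact hm.stronglyMeasurable.integral_prod_right.measurable

lemma IsCovolumeMeasure.integral_nonneg_of_intervalIntegral_pos (hμ : IsCovolumeMeasure haarSL G μ)
    (hψm : Measurable ψ) (hψG : ∀ γ ∈ G, ∀ g, ψ (γ * g) = ψ g) (hψM : ∀ g, ‖ψ g‖ ≤ M)
    (hpos : ∀ᵐ g ∂μ, ∃ n : ℕ, 0 < ∫ t in (0 : ℝ)..n, ψ (g * diagFlow t)) :
    0 ≤ ∫ g, ψ g ∂μ := by
  have : IsFiniteMeasure μ := ⟨hμ.lt_top⟩
  have hfm := measurable_intervalIntegral_mul_diagFlow hψm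
  have hfM (g) : ‖∫ t in (0 : ℝ)..1, ψ (g * diagFlow t)‖ ≤ M := by
    simpa using intervalIntegral.norm_integral_le_of_norm_le_const (a := (0 : ℝ)) (b := 1)
      fun t _ => hψM (g * diagFlow t)
  rw [← hμ.integral_intervalIntegral_mul_diagFlow hψm hψG hψM]
  refine hμ.integral_nonneg_of_birkhoffSum_pos hfm
    (fun γ hγ g => by simp only [mul_assoc, hψG γ hγ])
    (Integrable.of_bound hfm.aestronglyMeasurable M (ae_of_all _ hfM)) (diagFlow 1) ?_
  simpa only [birkhoffSum_mul_diagFlow (intervalIntegrable_mul_diagFlow hψm hψM)] using hpos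

end MaximalFlow

section ExpandingSet

variable {G : Subgroup SL(2, ℝ)} {S : Set G}

lemma exists_pos_forall_frobSq_le (hS : S.Finite) :
    ∃ C > 0, ∀ s : G, s ∈ S ∨ s⁻¹ ∈ S → 2 * frobSq s ^ 2 * Real.exp (frobSq s ^ 2) ≤ C := by
  obtain ⟨C, hC⟩ := (hS.image fun s : G =>
    2 * frobSq (s : SL(2, ℝ)) ^ 2 * Real.exp (frobSq (s : SL(2, ℝ)) ^ 2)).bddAbove
  refine ⟨max C 1, by positivity, fun s hs => le_max_of_le_left ?_⟩
  rcases hs with hs | hs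
  · exact hC ⟨s, hs, rfl⟩
  · simpa only [Subgroup.coe_inv, frobSq_inv] using hC ⟨s⁻¹, hs, rfl⟩

/- Were the saturation of `expandingSet S ε` conull, the truncated weight `φ` would have average at
most `C / ε` on `G \ SL(2, ℝ)` by the maximal ergodic theorem, whereas its average can be made
arbitrarily large. -/
lemma IsCovolumeMeasure.haarSL_expandingSet_eq_zero [DiscreteTopology G] {μ : Measure SL(2, ℝ)}
    (hμ : IsCovolumeMeasure haarSL G μ) (hnc : ¬ CompactSpace (MulAction.orbitRel.Quotient G ℍ))
    (hS : S.Finite) {ε : ℝ} (hε : 0 < ε) : haarSL (expandingSet S ε) = 0 := by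
  have : IsFiniteMeasure μ := ⟨hμ.lt_top⟩
  have : Countable G := TopologicalSpace.separableSpace_iff_countable.1 inferInstance
  set E : Set SL(2, ℝ) := G * expandingSet S ε
  have hupper {b : SL(2, ℝ)} (hb : b 1 0 = 0) (g) : g * b ∈ E ↔ g ∈ E :=
    mul_mem_coe_mul_iff (mul_mem_expandingSet_iff hb ε) g
  refine measure_mono_null (subset_mul_right _ G.one_mem) ((hμ.haarSL_eq_zero_or_compl
    (measurableSet_coe_mul G (measurableSet_expandingSet S ε)) (isLeftInvariantSet_coe_mul G _)
    (fun x => hupper (by simp)) fun t => hupper (by simp)).resolve_right fun hconull => ?_)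
  obtain ⟨C, hC0, hC⟩ := exists_pos_forall_frobSq_le hS
  obtain ⟨M, hM⟩ := hμ.exists_lt_integral_min_exp_orbitDist hnc (μ.real univ / (ε / C))
  set φ : SL(2, ℝ) → ℝ := fun g => min (Real.exp (orbitDist G g)) (Real.exp M)
  have hφm : Measurable φ :=
    ((Real.continuous_exp.comp continuous_orbitDist).min continuous_const).measurable
  have hφ0 (g) : 0 ≤ φ g := by positivity
  have hφM (g) : ‖φ g‖ ≤ Real.exp M := (Real.norm_of_nonneg (hφ0 g)).trans_le (min_le_right _ _)
  have hφG : ∀ γ ∈ G, ∀ g, φ (γ * g) = φ g := fun γ hγ g => by simp only [φ, orbitDist_mul hγ]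
  have hφle (g) : φ g ≤ frobSq g := (min_le_left _ _).trans (exp_orbitDist_le_frobSq g)
  have hpos : ∀ᵐ g ∂μ, ∃ n : ℕ, 0 < ∫ t in (0 : ℝ)..n, (1 - ε / C * φ (g * diagFlow t)) := by
    filter_upwards [hμ.le.absolutelyContinuous hconull]
    rintro _ ⟨γ, hγ, h, hh, rfl⟩
    simpa only [mul_assoc, hφG γ hγ] using exists_intervalIntegral_pos_of_mem_expandingSet
      (intervalIntegrable_mul_diagFlow hφm hφM) hφM hφ0 hφle hφG hC0 hC hε hh
  have hnonneg := hμ.integral_nonneg_of_intervalIntegral_pos (ψ := fun g => 1 - ε / C * φ g)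
    (M := 1 + ε / C * Real.exp M) (measurable_const.sub (hφm.const_mul _))
    (fun γ hγ g => by simp only [hφG γ hγ]) (fun g => ?_) hpos
  · rw [integral_sub (integrable_const _) ((hμ.integrable_min_exp_orbitDist M).const_mul _),
      integral_const, integral_const_mul, smul_eq_mul, mul_one] at hnonneg
    rw [div_lt_iff₀' (by positivity)] at hM
    linarith
  · refine (norm_sub_le _ _).trans ?_
    rw [norm_one, norm_mul, Real.norm_of_nonneg (by positivity)]
    gcongr
    exact hφM g

end ExpandingSet

/-! ### Rotations and the boundary circle -/

/-- The element of `SO(2)` that acts on the boundary circle of the disc as the rotation by `θ`. -/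
noncomputable def rotation (θ : ℝ) : SL(2, ℝ) :=
  ⟨!![Real.cos (θ / 2), Real.sin (θ / 2); -Real.sin (θ / 2), Real.cos (θ / 2)], by
    rw [Matrix.det_fin_two_of]
    linarith [Real.sin_sq_add_cos_sq (θ / 2)]⟩

@[simp] lemma rotation_coe (θ : ℝ) : (rotation θ : Matrix (Fin 2) (Fin 2) ℝ) =
    !![Real.cos (θ / 2), Real.sin (θ / 2); -Real.sin (θ / 2), Real.cos (θ / 2)] := rfl

lemma continuous_rotation : Continuous rotation :=
  continuous_of_continuous_entries fun i j => by
    fin_cases i <;> fin_cases j <;> simp only [rotation_coe] <;> fun_prop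

lemma rotation_zero : rotation 0 = 1 := by
  ext i j
  fin_cases i <;> fin_cases j <;> simp

lemma rotation_add (θ η : ℝ) : rotation (θ + η) = rotation θ * rotation η := by
  ext i j
  fin_cases i <;> fin_cases j <;>
    simp [-Matrix.SpecialLinearGroup.coe_mul, mul_entry, add_div, Real.cos_add, Real.sin_add] <;>
    ring

lemma colSq_rotation (θ : ℝ) : colSq (rotation θ) 0 = 1 := by
  simp [colSq]

/- The Iwasawa decomposition: rotate the first column of `g` to the horizontal axis. -/
lemma exists_eq_rotation_mul (g : SL(2, ℝ)) :
    ∃ η : ℝ, ∃ b : SL(2, ℝ), b 1 0 = 0 ∧ g = rotation η * b := by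
  set z : ℂ := ⟨g 0 0, -g 1 0⟩
  have hz0 : z ≠ 0 := by
    intro h0
    have h00 : g 0 0 = 0 := congrArg Complex.re h0
    have h10 : g 1 0 = 0 := neg_eq_zero.1 (congrArg Complex.im h0)
    simpa [h00, h10] using det_entries g
  refine ⟨2 * z.arg, rotation (-(2 * z.arg)) * g, ?_, ?_⟩
  · have hcos := Complex.cos_arg hz0
    have hsin := Complex.sin_arg z
    simp only [mul_entry, rotation_coe, Matrix.of_apply, Matrix.cons_val', Matrix.cons_val_zero,
      Matrix.cons_val_one, Matrix.cons_val_fin_one, neg_div, Real.sin_neg, Real.cos_neg, neg_neg]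
    rw [mul_div_cancel_left₀ z.arg two_ne_zero, hcos, hsin]
    ring
  · rw [← mul_assoc, ← rotation_add, add_neg_cancel, rotation_zero, one_mul]

/- By Fubini, almost every right translate of `θ ↦ rotation θ` avoids `N`; by the Iwasawa
decomposition such a translate differs from the curve itself by a shift of `θ` and an upper
triangular factor. -/
lemma ae_rotation_notMem {N : Set SL(2, ℝ)} (hN : MeasurableSet N) (hN0 : haarSL N = 0)
    (hNb : ∀ h b : SL(2, ℝ), b 1 0 = 0 → (h * b ∈ N ↔ h ∈ N)) :
    ∀ᵐ θ : ℝ, rotation θ ∉ N := by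
  have hmeas : MeasurableSet {p : ℝ × SL(2, ℝ) | rotation p.1 * p.2 ∈ N} :=
    ((continuous_rotation.measurable.comp measurable_fst).mul measurable_snd) hN
  have hprod : ((volume : Measure ℝ).prod haarSL) {p | rotation p.1 * p.2 ∈ N} = 0 := by
    rw [Measure.measure_prod_null hmeas]
    exact ae_of_all _ fun θ => (measure_preimage_mul haarSL (rotation θ) N).trans hN0
  rw [Measure.prod_apply_symm hmeas, lintegral_eq_zero_iff (measurable_measure_prodMk_right hmeas)]
    at hprod
  obtain ⟨g, hg⟩ := hprod.exists
  obtain ⟨η, b, hb, rfl⟩ := exists_eq_rotation_mul g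
  have hshift : volume ((· + η) ⁻¹' {θ | rotation θ ∈ N}) = 0 := by
    refine Eq.trans (congrArg _ ?_) hg
    ext θ
    simp only [mem_preimage, mem_ofPred_eq]
    rw [rotation_add, ← hNb _ b hb, mul_assoc]
  rw [measure_preimage_add_right] at hshift
  simpa [ae_iff] using hshift

lemma hasDerivAt_discMap (g : SL(2, ℝ)) {w : ℂ} (hw : ‖w‖ ≤ 1) :
    HasDerivAt (discMap g) (1 / (conj (discB g) * w + conj (discA g)) ^ 2) w := by
  have hnum : HasDerivAt (fun w => discA g * w + discB g) (discA g) w := by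
    simpa using ((hasDerivAt_id w).const_mul (discA g)).add_const (discB g)
  have hden : HasDerivAt (fun w => conj (discB g) * w + conj (discA g)) (conj (discB g)) w := by
    simpa using ((hasDerivAt_id w).const_mul (conj (discB g))).add_const (conj (discA g))
  have hnorm : discA g * conj (discA g) - discB g * conj (discB g) = 1 := by
    rw [Complex.mul_conj, Complex.mul_conj, ← Complex.ofReal_sub, normSq_discA_sub,
      Complex.ofReal_one]
  refine (hnum.fun_div hden (discMap_denom_ne_zero g hw)).congr_deriv ?_
  congr 1
  linear_combination hnorm

lemma absDeriv_boundaryMap (g : SL(2, ℝ)) (p : Circle) :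
    absDeriv (boundaryMap g) p = (Complex.normSq (conj (discB g) * p + conj (discA g)))⁻¹ := by
  have hexp : HasDerivAt (fun t : ℝ => (p : ℂ) * Circle.exp t) (p * Complex.I) 0 := by
    have hlin : HasDerivAt (fun t : ℝ => (t : ℂ) * Complex.I) Complex.I 0 := by
      simpa using (Complex.ofRealCLM.hasDerivAt (x := (0 : ℝ))).mul_const Complex.I
    simpa using hlin.cexp.const_mul (p : ℂ)
  have hp : (p : ℂ) * Circle.exp 0 = p := by simp
  have hderiv := (hp ▸ hasDerivAt_discMap g (Circle.norm_coe p).le).comp (0 : ℝ) hexp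
  change ‖deriv (discMap g ∘ fun t : ℝ => (p : ℂ) * Circle.exp t) 0‖ = _
  rw [hderiv.deriv, hp, norm_mul, norm_mul, Circle.norm_coe, Complex.norm_I, one_mul, mul_one,
    norm_div, norm_one, one_div, norm_pow, ← Complex.normSq_eq_norm_sq]

lemma normSq_discMap_denom (g : SL(2, ℝ)) (θ : ℝ) :
    Complex.normSq (conj (discB g) * Circle.exp θ + conj (discA g)) =
      colSq (g * rotation θ) 0 := by
  have hexp : (Circle.exp θ : ℂ) = ⟨Real.cos θ, Real.sin θ⟩ := by
    rw [Circle.coe_exp]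
    exact Complex.ext (Complex.exp_ofReal_mul_I_re θ) (Complex.exp_ofReal_mul_I_im θ)
  have hcos : Real.cos θ = Real.cos (θ / 2) ^ 2 - Real.sin (θ / 2) ^ 2 := by
    rw [← Real.cos_two_mul', mul_div_cancel₀ θ two_ne_zero]
  have hsin : Real.sin θ = 2 * Real.sin (θ / 2) * Real.cos (θ / 2) := by
    rw [← Real.sin_two_mul, mul_div_cancel₀ θ two_ne_zero]
  rw [hexp, hcos, hsin]
  simp only [Complex.normSq_apply, Complex.add_re, Complex.add_im, Complex.mul_re, Complex.mul_im,
    Complex.conj_re, Complex.conj_im, discA, discB, colSq, mul_entry, rotation_coe, Matrix.of_apply,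
    Matrix.cons_val', Matrix.cons_val_zero, Matrix.cons_val_one, Matrix.cons_val_fin_one]
  linear_combination ((((g 0 0 - g 1 1) / 2) ^ 2 + ((g 0 1 + g 1 0) / 2) ^ 2) *
    (Real.sin (θ / 2) ^ 2 + Real.cos (θ / 2) ^ 2) -
    (((g 0 0 + g 1 1) / 2) ^ 2 + ((g 0 1 - g 1 0) / 2) ^ 2)) * Real.sin_sq_add_cos_sq (θ / 2)

lemma log_absDeriv_boundaryMap (g : SL(2, ℝ)) (θ : ℝ) :
    Real.log (absDeriv (boundaryMap g) (Circle.exp θ)) = -Real.log (colSq (g * rotation θ) 0) := by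
  rw [absDeriv_boundaryMap, normSq_discMap_denom, Real.log_inv]

/-! ### The Lyapunov expansion exponent -/

section Lyapunov

variable {Γ : Type*} [Group Γ] {act : Γ → Circle → Circle} {S : Set Γ} {p : Circle}

lemma lyapunovExpansionExponent_nonneg (h1 : absDeriv (act 1) p = 1) :
    0 ≤ lyapunovExpansionExponent act S p := by
  refine le_limsup_of_frequently_le (Frequently.of_forall fun R => ?_)
  have hmem : (1 : Γ) ∈ wordBall S R := ⟨[], by simp, by simp, rfl⟩
  refine le_trans ?_ (le_iSup₂ (1 : Γ) hmem)
  simp [h1]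

lemma lyapunovExpansionExponent_le {ε J : ℝ}
    (h : ∀ n : ℕ, ∀ g ∈ wordBall S n, Real.log (absDeriv (act g) p) ≤ ε * n + J) :
    lyapunovExpansionExponent act S p ≤ ε := by
  have hlim : Tendsto (fun R : ℕ => ((ε + J / R : ℝ) : EReal)) atTop (𝓝 (ε : EReal)) := by
    refine (continuous_coe_real_ereal.tendsto ε).comp ?_
    simpa using (tendsto_const_div_atTop_nhds_zero_nat J).const_add ε
  rw [← hlim.limsup_eq]
  refine limsup_le_limsup ?_
  filter_upwards [eventually_gt_atTop 0] with R hR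
  refine iSup₂_le fun g hg => EReal.coe_le_coe_iff.2 ?_
  rw [one_div, inv_mul_le_iff₀ (by positivity)]
  refine (h R g hg).trans_eq ?_
  field_simp

end Lyapunov

lemma lyapunovExpansionExponent_le_of_rotation_notMem {G : Subgroup SL(2, ℝ)} {S : Set G} {θ ε : ℝ}
    (hθ : rotation θ ∉ expandingSet S ε) :
    lyapunovExpansionExponent (fun g : G => boundaryMap (g : SL(2, ℝ))) S (Circle.exp θ) ≤ ε := by
  simp only [expandingSet, mem_ofPred_eq] at hθ
  push Not at hθ
  obtain ⟨J, hJ⟩ := hθ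
  refine lyapunovExpansionExponent_le (J := J) fun n g hg => ?_
  simpa [log_absDeriv_boundaryMap, colSq_rotation] using hJ n g hg

end Fuchsian

open Fuchsian MeasureTheory Filter Topology in
theorem theorem1p3_general (G : Subgroup SL(2, ℝ)) [DiscreteTopology G]
    (hcofinite : Fuchsian.HasFiniteCoarea G)
    (hnoncocompact : ¬ CompactSpace (MulAction.orbitRel.Quotient G ℍ))
    (S : Set G) (hSfinite : S.Finite) :
    ∀ᵐ θ : ℝ, Fuchsian.lyapunovExpansionExponent
      (fun g : G => Fuchsian.boundaryMap (g : SL(2, ℝ))) S (Circle.exp θ) = 0 := by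
  have : Countable G := TopologicalSpace.separableSpace_iff_countable.1 inferInstance
  obtain ⟨μ, hμ⟩ := exists_isCovolumeMeasure hcofinite
  have hae : ∀ᵐ θ : ℝ, ∀ m : ℕ, rotation θ ∉ expandingSet S (1 / (m + 1)) :=
    ae_all_iff.2 fun m => ae_rotation_notMem (measurableSet_expandingSet S _)
      (hμ.haarSL_expandingSet_eq_zero hnoncocompact hSfinite Nat.one_div_pos_of_nat)
      fun h b hb => mul_mem_expandingSet_iff hb _ h
  filter_upwards [hae] with θ hθ
  have hlim : Tendsto (fun m : ℕ => ((1 / (m + 1) : ℝ) : EReal)) atTop (𝓝 0) :=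
    (continuous_coe_real_ereal.tendsto 0).comp tendsto_one_div_add_atTop_nhds_zero_nat
  refine le_antisymm
    (ge_of_tendsto' hlim fun m => lyapunovExpansionExponent_le_of_rotation_notMem (hθ m))
    (lyapunovExpansionExponent_nonneg ?_)
  change absDeriv (boundaryMap 1) _ = 1
  rw [absDeriv_boundaryMap, normSq_discMap_denom, one_mul, colSq_rotation, inv_one]

theorem theorem1p3 (G : Subgroup SL(2, ℝ)) (hdiscrete : DiscreteTopology G)
    (hcofinite : Fuchsian.HasFiniteCoarea G)
    (hnoncocompact : ¬ CompactSpace (MulAction.orbitRel.Quotient G ℍ))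
    (S : Set G) (hSfinite : S.Finite) (hSgen : Subgroup.closure S = ⊤) :
    ∀ᵐ θ : ℝ, Fuchsian.lyapunovExpansionExponent
      (fun g : G => Fuchsian.boundaryMap (g : SL(2, ℝ))) S (Circle.exp θ) = 0 :=
  theorem1p3_general G hcofinite hnoncocompact S hSfinite
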